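/- For a finite-dimensional space $W$ of meromorphic functions on $\mathbb C$, $\dim W=d$, the exponents of $W$ at $z\in\mathbb C$ are the $d$ integers that occur as orders at $z$ of nonzero elements of $W$; $z$ is a singular point of $W$ if they differ from $0,\dots,d-1$. Let $\bar D_W$ be the unique monic linear differential operator of order $d$ with meromorphic coefficients annihilating $W$. If $W$ has finitely many singular points, let $R_W(x)=\prod_{z}(x-z)^{k_z}$, the product being over the singular points $z$ of $W$ and $k_z$ being the smallest natural number such that the coefficients of $(x-z)^{k_z}\bar D_W$ have no pole at $z$. The regularized fundamental operator of $W$ is $D_W=R_W\bar D_W$. The conjugate space $W^\star$ is spanned by the functions $\mathrm{Wr}(f_1,\dots,f_{d-1})/\mathrm{Wr}_W$, $f_i\in W$, where $\mathrm{Wr}$ denotes the Wronskian and $\mathrm{Wr}_W$ is the Wronskian of a basis of $W$; the regularized conjugate space is $W^\dagger=\{f/R_W : f\in W^\star\}$. Let $\lambda_1,\dots,\lambda_n$ be distinct complex numbers, let $N_1,\dots,N_n$ be positive integers, $N=N_1+\dots+N_n$, and for $1\le i\le n$ let $0<n_{i1}<\dots<n_{iN_i}$ be integers and $p_{ij}\in\mathbb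 C[x]$ polynomials of degree $n_{ij}$. Let $V$ be the complex vector space spanned by the functions $p_{ij}(x)e^{\lambda_i x}$, $1\le i\le n$, $1\le j\le N_i$. Let $z_1,\dots,z_m$ be the distinct singular points of $V$, and let $$\{0<\dots<N-M_a-1<N-M_a+m_{a1}<\dots<N-M_a+m_{aM_a}\}$$ be the set of exponents of $V$ at $z_a$, where $1\le M_a\le N$ and $0<m_{a1}<\dots<m_{aM_a}$. Put $M=M_1+\dots+M_m$. For each $a$ let $\gamma_a$ be a counterclockwise circle centred at $z_a$ such that no other singular point of $V$ lies on or inside it, and let $U$ (the bispectral dual of $V$) be the complex vector space spanned by the functions $$\hat f_a(u)=\oint_{\gamma_a}e^{ux}f(x)\,dx,\qquad 1\le a\le m,\quad f\in V^\dagger .$$ Then: (i) $\dim U=M$. (ii) For $1\le a\le m$ and $1\le b\le M_a$, the space $U$ contains a function of the form $q_{ab}(u)e^{z_au}$, where $q_{ab}$ is a polynomial of degree $m_{ab}$. (iii) The regularized fundamental operator of $V$ has the form $D_V=\sum_{i=0}^M\sum_{j=0}^N A_{ij}x^i\partial_x^j$ with $A_{ij}\in\mathbb C$, and $\sum_{i=0}^M\sum_{j=0}^N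 A_{ij}u^j\partial_u^i$ is the regularized fundamental operator of $U$. (iv) The set of singular points of $U$ in $\mathbb C$ is $\{\lambda_1,\dots,\lambda_n\}$. (v) For $1\le i\le n$, the set of exponents of $U$ at $\lambda_i$ is $$\{0<\dots<M-N_i-1<M-N_i+n_{i1}<M-N_i+n_{i2}<\dots<M-N_i+n_{iN_i}\}.$$ -/

import Mathlib

open Filter

noncomputable section

/-- The Wronskian of `f 0, …, f (k - 1)`: the determinant of the matrix whose `j`-th row is
`f j, (f j)', …, (f j)^(k-1)`.  For `k = 0` it is the constant function `1`. -/
def Wronskian {k : ℕ} (f : Fin k → ℂ → ℂ) (x : ℂ) : ℂ :=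
  (Matrix.of fun j l : Fin k => iteratedDeriv (l : ℕ) (f j) x).det

/-- The set of exponents at `z` of a space `W` of meromorphic functions: the orders at `z` of the
elements of `W` (the zero function, of order `⊤`, does not contribute). -/
def exponents (W : Submodule ℂ (ℂ → ℂ)) (z : ℂ) : Set ℤ :=
  {e | ∃ f ∈ W, meromorphicOrderAt f z = (e : WithTop ℤ)}

/-- `z` is singular if the exponents at `z` are not `0, …, dim W - 1`. -/
def singularPoints (W : Submodule ℂ (ℂ → ℂ)) : Set ℂ :=
  {z | exponents W z ≠ Set.Ico (0 : ℤ) (Module.finrank ℂ W)}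

/-- `A 0 + A 1 ∂ + ⋯ + A N ∂ ^ N` is a monic differential operator with meromorphic coefficients,
of order `N = dim W`, which annihilates `W`.  Identities between meromorphic functions are read
off a discrete closed set of points. -/
structure IsMonicFundamentalOperator (N : ℕ) (W : Submodule ℂ (ℂ → ℂ))
    (A : Fin (N + 1) → ℂ → ℂ) : Prop where
  dim : Module.finrank ℂ W = N
  meromorphic : ∀ j z, MeromorphicAt (A j) z
  monic : ∀ x, A (Fin.last N) x = 1
  annihilates : ∀ f ∈ W,
    (fun x => ∑ j : Fin (N + 1), A j x * iteratedDeriv (j : ℕ) f x) =ᶠ[codiscrete ℂ] 0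

/-- The smallest natural number `k` such that no coefficient of `(x - z) ^ k * D` has a pole
at `z`, where `D` is the monic fundamental operator of `W`. -/
def poleOrder (W : Submodule ℂ (ℂ → ℂ)) (z : ℂ) : ℕ :=
  sInf {k : ℕ | ∃ A : Fin (Module.finrank ℂ W + 1) → ℂ → ℂ,
    IsMonicFundamentalOperator (Module.finrank ℂ W) W A ∧
      ∀ j, 0 ≤ meromorphicOrderAt (fun x => (x - z) ^ k * A j x) z}

/-- The polynomial function `∏ (x - z) ^ M_z` over the singular points `z` of `W`. -/
def regularizingFactor (W : Submodule ℂ (ℂ → ℂ)) (x : ℂ) : ℂ :=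
  ∏ᶠ z ∈ singularPoints W, (x - z) ^ poleOrder W z

/-- `D 0 + D 1 ∂ + ⋯ + D N ∂ ^ N` is the regularized fundamental operator of `W`: the monic
fundamental operator multiplied by `∏ (x - z) ^ M_z`.  Its coefficients are entire, that is, their
removable singularities have been removed. -/
def IsRegularizedFundamentalOperator (N : ℕ) (W : Submodule ℂ (ℂ → ℂ))
    (D : Fin (N + 1) → ℂ → ℂ) : Prop :=
  (singularPoints W).Finite ∧
    ∃ A : Fin (N + 1) → ℂ → ℂ, IsMonicFundamentalOperator N W A ∧
      ∀ j, Differentiable ℂ (D j) ∧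
        D j =ᶠ[codiscrete ℂ] fun x => regularizingFactor W x * A j x

/-- The conjugate space, spanned by the functions `Wr(f_1, …, f_{N-1}) / Wr_W` with `f_i ∈ W`,
where `N = dim W` and `Wr_W` is the Wronskian of a basis of `W`.  Another basis changes `Wr_W` by
a nonzero constant factor only, so that letting the basis vary does not change the span. -/
def conjugateSpace (W : Submodule ℂ (ℂ → ℂ)) : Submodule ℂ (ℂ → ℂ) :=
  Submodule.span ℂ {g | ∃ (b : Module.Basis (Fin (Module.finrank ℂ W)) ℂ W)
    (f : Fin (Module.finrank ℂ W - 1) → W),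
      g = fun x => Wronskian (fun i => (f i : ℂ → ℂ)) x / Wronskian (fun i => (b i : ℂ → ℂ)) x}

/-- The regularized conjugate space, spanned by the functions `f * ∏ (x - z) ^ (-M_z)` with `f` in
the conjugate space. -/
def regularizedConjugateSpace (W : Submodule ℂ (ℂ → ℂ)) : Submodule ℂ (ℂ → ℂ) :=
  Submodule.span ℂ {g | ∃ f ∈ conjugateSpace W, g = fun x => f x * (regularizingFactor W x)⁻¹}

/-- The circle of radius `r z` around a singular point `z` is small: it neither meets nor encloses
another singular point. -/
def SmallCircles (W : Submodule ℂ (ℂ → ℂ)) (r : ℂ → ℝ) : Prop :=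
  ∀ z ∈ singularPoints W, 0 < r z ∧
    ∀ w ∈ singularPoints W, w ≠ z → w ∉ Metric.closedBall z (r z)

/-- The bispectral dual, spanned by the functions `u ↦ ∮ exp (u x) f(x) dx` over the circles of
radius `r z` around the singular points `z` of `W`, with `f` in the regularized conjugate space. -/
def bispectralDual (W : Submodule ℂ (ℂ → ℂ)) (r : ℂ → ℝ) : Submodule ℂ (ℂ → ℂ) :=
  Submodule.span ℂ {g | ∃ z ∈ singularPoints W, ∃ f ∈ regularizedConjugateSpace W,
    g = fun u => ∮ x in C(z, r z), Complex.exp (u * x) * f x}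

/-- The span of the functions `p_{ij}(x) exp (λ_i x)`. -/
def quasiPolynomialSpace {n : ℕ} {k : Fin n → ℕ} (p : ∀ i, Fin (k i) → Polynomial ℂ)
    (lam : Fin n → ℂ) : Submodule ℂ (ℂ → ℂ) :=
  Submodule.span ℂ {g | ∃ (i : Fin n) (j : Fin (k i)),
    g = fun x => (p i j).eval x * Complex.exp (lam i * x)}

/-- The set `{0 < ⋯ < N - k - 1 < N - k + e_1 < ⋯ < N - k + e_k}` of integers. -/
def shiftedExponents (N k : ℕ) (e : Fin k → ℕ) : Set ℤ :=
  Set.Ico (0 : ℤ) ((N : ℤ) - k) ∪ Set.range fun b : Fin k => (N : ℤ) - k + e b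

end

/-!
Let `D = ∑ c_j(x) ∂^j` be the primitive operator of `V`: its coefficients are polynomials without
common zero, the leading one is monic, and `D V = 0`.  It is the regularized fundamental operator
of `V`, and comparing the zeros of its indicial polynomial at `z_a` with the exponents of `V` shows
that `c_N = ∏ (x - z_a)^(M_a)`.

Variation of parameters for the equation `D y = D e^(ux)` gives, for each `f ∈ V^†`, a
single-valued primitive of `D(e^(ux)) f` near `γ_a`.  Hence `∮ D(e^(ux)) f dx = 0`, which says that
the operator `D^♯` obtained from `D` by exchanging `x` and `∂` annihilates `U`.  Computing the
residues of `e^(ux) f(x)` at `z_a` shows that `U` is spanned by functions `q_ab(u) e^(z_a u)` with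
`deg q_ab = m_ab`.

The exchange of `x` and `∂` carries the action of `D` on quasi-polynomials `p(x) e^(λ_i x)` near
`x = ∞` to the action of `D^♯` on power series at `u = λ_i`: the degrees of the `p_ij` are the
zeros of one indicial polynomial, and they determine the exponents of `U` at `λ_i` through the
other.  They also give the leading coefficient `∏ (u - λ_i)^(N_i)` of `D^♯`, so that `D^♯` is the
primitive operator of `U`.
-/

open scoped Topology
open Polynomial

noncomputable section

/-- The space of entire functions, the ambient space of all solution spaces. -/
def entireFunctions : Submodule ℂ (ℂ → ℂ) where
  carrier := {f | Differentiable ℂ f}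
  add_mem' hf hg := hf.add hg
  zero_mem' := differentiable_const 0
  smul_mem' c _ hf := hf.const_smul c

lemma differentiable_iteratedDeriv {f : ℂ → ℂ} (hf : Differentiable ℂ f) (l : ℕ) :
    Differentiable ℂ (iteratedDeriv l f) :=
  (hf.contDiff (n := ⊤)).differentiable_iteratedDeriv l (by exact_mod_cast WithTop.coe_lt_top _)

/-- Differentiation as an endomorphism of the space of entire functions. -/
def entireDeriv : Module.End ℂ entireFunctions where
  toFun f := ⟨deriv f, iteratedDeriv_one (f := (f : ℂ → ℂ)) ▸ differentiable_iteratedDeriv f.2 1⟩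
  map_add' f g := Subtype.ext <| funext fun x => deriv_add (f.2 x) (g.2 x)
  map_smul' c f := Subtype.ext <| funext fun x => deriv_const_smul c (f.2 x)

lemma coe_entireDeriv_pow (l : ℕ) (f : entireFunctions) :
    (((entireDeriv ^ l) f : entireFunctions) : ℂ → ℂ) = iteratedDeriv l f := by
  induction l with
  | zero => simp
  | succ l ih =>
    rw [pow_succ', Module.End.mul_apply, iteratedDeriv_succ, ← ih]
    rfl

/-- The value at `x` of the `l`-th derivative, as a linear form on entire functions. -/
def iteratedDerivForm (l : ℕ) (x : ℂ) : entireFunctions →ₗ[ℂ] ℂ :=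
  LinearMap.proj x ∘ₗ entireFunctions.subtype ∘ₗ entireDeriv ^ l

lemma iteratedDerivForm_apply (l : ℕ) (x : ℂ) (f : entireFunctions) :
    iteratedDerivForm l x f = iteratedDeriv l f x :=
  congrFun (coe_entireDeriv_pow l f) x

lemma iteratedDeriv_sum_smul {ι : Type*} {t : Finset ι} {c : ι → ℂ} {f : ι → ℂ → ℂ}
    (hf : ∀ i ∈ t, Differentiable ℂ (f i)) (l : ℕ) (x : ℂ) :
    iteratedDeriv l (∑ i ∈ t, c i • f i) x = ∑ i ∈ t, c i * iteratedDeriv l (f i) x := by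
  have hsmul : ∀ i ∈ t, ContDiffAt ℂ l (c i • f i) x := fun i hi =>
    ((hf i hi).const_smul (c i)).contDiff.contDiffAt
  rw [iteratedDeriv_sum hsmul]
  exact Finset.sum_congr rfl fun i hi => by
    rw [iteratedDeriv_const_smul (hf i hi).contDiff.contDiffAt, smul_eq_mul]

lemma meromorphicOrderAt_eq_natCast_iff {f : ℂ → ℂ} (hf : Differentiable ℂ f) {z : ℂ} {s : ℕ} :
    meromorphicOrderAt f z = ((s : ℤ) : WithTop ℤ) ↔
      (∀ k < s, iteratedDeriv k f z = 0) ∧ iteratedDeriv s f z ≠ 0 := by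
  rw [← analyticOrderAt_eq_nat_iff_iteratedDeriv_eq_zero (hf.analyticAt z),
    (hf.analyticAt z).meromorphicOrderAt_eq]
  cases analyticOrderAt f z with
  | top => simp
  | coe n => rw [ENat.map_natCast]; norm_cast

lemma exists_meromorphicOrderAt_eq_natCast {f : ℂ → ℂ} (hf : Differentiable ℂ f) (hf0 : f ≠ 0)
    (z : ℂ) : ∃ s : ℕ, meromorphicOrderAt f z = ((s : ℤ) : WithTop ℤ) := by
  obtain ⟨s, hs⟩ := ENat.ne_top_iff_exists.1
    ((AnalyticOnNhd.analyticOrderAt_eq_top_iff_eq_zero z fun w => hf.analyticAt w).not.2 hf0)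
  exact ⟨s, by rw [(hf.analyticAt z).meromorphicOrderAt_eq, ← hs, ENat.map_natCast]⟩

lemma exists_eq_pow_mul {f : ℂ → ℂ} (hf : Differentiable ℂ f) {z : ℂ} {s : ℕ}
    (h : meromorphicOrderAt f z = ((s : ℤ) : WithTop ℤ)) :
    ∃ u : ℂ → ℂ, Differentiable ℂ u ∧ u z ≠ 0 ∧ ∀ x, f x = (x - z) ^ s * u x := by
  induction s generalizing f with
  | zero => exact ⟨f, hf, by simpa using ((meromorphicOrderAt_eq_natCast_iff hf).1 h).2, by simp⟩
  | succ s ih =>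
    have hfz : f z = 0 := by simpa using ((meromorphicOrderAt_eq_natCast_iff hf).1 h).1 0 (by simp)
    have hg : Differentiable ℂ (dslope f z) := differentiableOn_univ.1
      ((Complex.differentiableOn_dslope univ_mem).2 hf.differentiableOn)
    have hfg : f = (fun x => x - z) * dslope f z := by
      funext x
      exact (sub_smul_dslope_of_zero hfz x).symm
    have hord : meromorphicOrderAt (dslope f z) z = ((s : ℤ) : WithTop ℤ) := by
      rw [hfg, meromorphicOrderAt_mul (by fun_prop) (hg.analyticAt z).meromorphicAt,
        meromorphicOrderAt_id_sub_const, add_comm] at h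
      refine WithTop.add_right_cancel WithTop.one_ne_top (h.trans ?_)
      norm_cast
    obtain ⟨u, hu, huz, hgu⟩ := ih hg hord
    refine ⟨u, hu, huz, fun x => ?_⟩
    rw [congrFun hfg x, Pi.mul_apply, hgu, pow_succ', mul_assoc]

lemma cast_descFactorial_succ (s j : ℕ) :
    (s.descFactorial (j + 1) : ℂ) = ((s : ℂ) - j) * s.descFactorial j := by
  simp only [← descPochhammer_eval_eq_descFactorial, descPochhammer_succ_eval, mul_comm]

lemma exists_iteratedDeriv_eq_zpow_mul {f u : ℂ → ℂ} (hu : Differentiable ℂ u) {z : ℂ} {s : ℕ}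
    (hfu : ∀ x, f x = (x - z) ^ s * u x) (j : ℕ) :
    ∃ v : ℂ → ℂ, Differentiable ℂ v ∧ v z = s.descFactorial j * u z ∧
      ∀ x ≠ z, iteratedDeriv j f x = (x - z) ^ ((s : ℤ) - j) * v x := by
  induction j with
  | zero => exact ⟨u, hu, by simp, fun x _ => by simp [hfu]⟩
  | succ j ih =>
    obtain ⟨v, hv, hvz, hfv⟩ := ih
    have : Differentiable ℂ (deriv v) := by
      simpa only [iteratedDeriv_one] using differentiable_iteratedDeriv hv 1
    refine ⟨fun x => ((s : ℂ) - j) * v x + (x - z) * deriv v x, by fun_prop, ?_, fun x hx => ?_⟩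
    · simp only [cast_descFactorial_succ, sub_self, zero_mul, add_zero, hvz, mul_assoc]
    · have hxz : x - z ≠ 0 := sub_ne_zero.2 hx
      have hev : iteratedDeriv j f =ᶠ[𝓝 x] fun y => (y - z) ^ ((s : ℤ) - j) * v y := by
        filter_upwards [isOpen_ne.mem_nhds hx] with y hy using hfv y hy
      have hd : HasDerivAt (fun y => (y - z) ^ ((s : ℤ) - j) * v y)
          ((((s : ℤ) - j : ℤ) : ℂ) * (x - z) ^ ((s : ℤ) - j - 1) * v x +
            (x - z) ^ ((s : ℤ) - j) * deriv v x) x :=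
        ((hasDerivAt_zpow _ (x - z) (Or.inl hxz)).comp_sub_const x z).fun_mul (hv x).hasDerivAt
      rw [iteratedDeriv_succ, hev.deriv_eq, hd.deriv,
        show (x - z) ^ ((s : ℤ) - j) = (x - z) ^ ((s : ℤ) - j - 1) * (x - z) by
          rw [← zpow_add_one₀ hxz, sub_add_cancel],
        show (s : ℤ) - ((j + 1 : ℕ) : ℤ) = (s : ℤ) - j - 1 by push_cast; ring]
      push_cast
      ring

lemma linearIndependent_of_injective_order {ι : Type*} {f : ι → ℂ → ℂ}
    (hf : ∀ i, Differentiable ℂ (f i)) {z : ℂ} {e : ι → ℕ} (he : Function.Injective e)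
    (hord : ∀ i, meromorphicOrderAt (f i) z = ((e i : ℤ) : WithTop ℤ)) :
    LinearIndependent ℂ f := by
  classical
  rw [linearIndependent_iff']
  intro t c hc
  by_contra! hne
  obtain ⟨i₀, hi₀, hc₀⟩ := hne
  -- Differentiating as often as the smallest order present isolates a single term.
  obtain ⟨i, hi, hmin⟩ := Finset.exists_min_image (t.filter fun i => c i ≠ 0) e
    ⟨i₀, by simp [hi₀, hc₀]⟩
  rw [Finset.mem_filter] at hi
  have hsum := iteratedDeriv_sum_smul (c := c) (fun j (_ : j ∈ t) => hf j) (e i) z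
  rw [hc, Pi.zero_def, iteratedDeriv_const, ite_self, Finset.sum_eq_single_of_mem i hi.1] at hsum
  · exact mul_ne_zero hi.2 ((meromorphicOrderAt_eq_natCast_iff (hf i)).1 (hord i)).2 hsum.symm
  · intro j hj hji
    by_cases hcj : c j = 0
    · rw [hcj, zero_mul]
    · have hlt : e i < e j :=
        (hmin j (Finset.mem_filter.2 ⟨hj, hcj⟩)).lt_of_ne fun h => hji (he h.symm)
      rw [((meromorphicOrderAt_eq_natCast_iff (hf j)).1 (hord j)).1 _ hlt, mul_zero]

lemma exists_natCast_eq_of_mem_exponents {W : Submodule ℂ (ℂ → ℂ)} (hW : W ≤ entireFunctions)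
    {z : ℂ} {k : ℤ} (hk : k ∈ exponents W z) : ∃ s : ℕ, k = s := by
  obtain ⟨f, hf, hfk⟩ := hk
  have h := ((hW hf).analyticAt z).meromorphicOrderAt_nonneg
  rw [hfk] at h
  exact Int.eq_ofNat_of_zero_le (by exact_mod_cast h)

lemma finrank_le_card_of_exponents {W : Submodule ℂ (ℂ → ℂ)} (hW : W ≤ entireFunctions) {z : ℂ}
    {E : Set ℕ} [Fintype E] (hE : ∀ s : ℕ, (s : ℤ) ∈ exponents W z → s ∈ E) :
    Module.finrank ℂ W ≤ Fintype.card E := by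
  let jet : W →ₗ[ℂ] E → ℂ :=
    LinearMap.pi fun s => iteratedDerivForm s z ∘ₗ Submodule.inclusion hW
  have hjet : Function.Injective jet := by
    refine (injective_iff_map_eq_zero jet).2 fun f hf => by_contra fun hf0 => ?_
    obtain ⟨s, hs⟩ := exists_meromorphicOrderAt_eq_natCast (hW f.2)
      (fun h => hf0 (Subtype.ext h)) z
    refine ((meromorphicOrderAt_eq_natCast_iff (hW f.2)).1 hs).2 ?_
    exact (iteratedDerivForm_apply s z _).symm.trans (congrFun hf ⟨s, hE s ⟨f, f.2, hs⟩⟩)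
  simpa using LinearMap.finrank_le_finrank_of_injective hjet

lemma exists_adapted_basis {W : Submodule ℂ (ℂ → ℂ)} (hW : W ≤ entireFunctions)
    [FiniteDimensional ℂ W] {d : ℕ} (hd : Module.finrank ℂ W = d) (z : ℂ) :
    ∃ (b : Module.Basis (Fin d) ℂ W) (e : Fin d → ℕ), Function.Injective e ∧
      (∀ i, meromorphicOrderAt (b i : ℂ → ℂ) z = ((e i : ℤ) : WithTop ℤ)) ∧
      exponents W z = Set.range fun i => (e i : ℤ) := by
  let E : Set ℕ := {s | (s : ℤ) ∈ exponents W z}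
  choose f hfW hord using fun s : E => s.2
  have hli : LinearIndependent ℂ fun s => (⟨f s, hfW s⟩ : W) :=
    .of_comp W.subtype <|
      linearIndependent_of_injective_order (fun s => hW (hfW s)) Subtype.val_injective hord
  have : Finite E := hli.finite
  have : Fintype E := Fintype.ofFinite E
  have hcard : Fintype.card E = Module.finrank ℂ W :=
    hli.fintype_card_le_finrank.antisymm (finrank_le_card_of_exponents hW fun s hs => hs)
  let σ : E ≃ Fin d := Fintype.equivFinOfCardEq (hcard.trans hd)
  refine ⟨(basisOfLinearIndependentOfCardEqFinrank' _ hli hcard).reindex σ, fun i => σ.symm i,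
    Subtype.val_injective.comp σ.symm.injective, fun i => by simpa using hord (σ.symm i), ?_⟩
  refine Set.Subset.antisymm (fun k hk => ?_) (Set.range_subset_iff.2 fun i => (σ.symm i).2)
  obtain ⟨s, rfl⟩ := exists_natCast_eq_of_mem_exponents hW hk
  exact ⟨σ ⟨s, hk⟩, by simp⟩

lemma exists_finset_exponents {W : Submodule ℂ (ℂ → ℂ)} (hW : W ≤ entireFunctions)
    [FiniteDimensional ℂ W] (z : ℂ) :
    ∃ S : Finset ℕ, S.card = Module.finrank ℂ W ∧ ∀ s : ℕ, s ∈ S ↔ (s : ℤ) ∈ exponents W z := by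
  obtain ⟨b, e, he, -, hexp⟩ := exists_adapted_basis hW rfl z
  exact ⟨Finset.univ.image e, by simp [Finset.card_image_of_injective _ he], by simp [hexp]⟩

/-- The polynomial `∑ β j * t (t - 1) ⋯ (t - j + 1)`.  Applied to the coefficients of a
homogeneous operator, it records the action of this operator on powers. -/
def newtonPolynomial {n : ℕ} (β : Fin n → ℂ) : ℂ[X] :=
  ∑ j, C (β j) * descPochhammer ℂ j

section NewtonPolynomial

variable {n : ℕ} {β : Fin n → ℂ}

lemma eval_natCast_newtonPolynomial (s : ℕ) :
    (newtonPolynomial β).eval (s : ℂ) = ∑ j, β j * (s.descFactorial j : ℂ) := by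
  simp [newtonPolynomial, eval_finsetSum, descPochhammer_eval_eq_descFactorial]

lemma eval_newtonPolynomial_of_lt {s : ℕ} (h : ∀ j : Fin n, (j : ℕ) ≤ s → β j = 0) :
    (newtonPolynomial β).eval (s : ℂ) = 0 := by
  rw [eval_natCast_newtonPolynomial]
  refine Finset.sum_eq_zero fun j _ => ?_
  rcases le_or_gt (j : ℕ) s with hj | hj
  · rw [h j hj, zero_mul]
  · rw [Nat.descFactorial_eq_zero_iff_lt.2 hj, Nat.cast_zero, mul_zero]

lemma eq_zero_of_eval_newtonPolynomial_of_lt {m : ℕ}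
    (h : ∀ s < m, (newtonPolynomial β).eval (s : ℂ) = 0) (j : Fin n) (hj : (j : ℕ) < m) :
    β j = 0 := by
  induction j using WellFoundedLT.induction with
  | _ j ih =>
    have hsum := h j hj
    rw [eval_natCast_newtonPolynomial, Finset.sum_eq_single j] at hsum
    · simpa [Nat.factorial_ne_zero] using hsum
    · intro i _ hij
      rcases lt_or_gt_of_ne hij with hlt | hgt
      · rw [ih i hlt ((Fin.lt_def.1 hlt).trans hj), zero_mul]
      · rw [Nat.descFactorial_eq_zero_iff_lt.2 hgt, Nat.cast_zero, mul_zero]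
    · simp

lemma degree_newtonPolynomial_lt {m : ℕ} (h : ∀ j : Fin n, m ≤ j → β j = 0) :
    (newtonPolynomial β).degree < m := by
  rw [← mem_degreeLT]
  refine Submodule.sum_mem _ fun j _ => ?_
  rcases le_or_gt m j with hj | hj
  · simp [h j hj]
  · refine mem_degreeLT.2 (lt_of_le_of_lt (degree_le_of_natDegree_le (n := j) ?_)
      (by exact_mod_cast hj))
    exact (natDegree_C_mul_le _ _).trans_eq (descPochhammer_natDegree _ _)

lemma eq_zero_of_eval_newtonPolynomial (S : Finset ℕ)
    (hS : ∀ s ∈ S, (newtonPolynomial β).eval (s : ℂ) = 0)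
    (hβ : ∀ j : Fin n, S.card ≤ j → β j = 0) : β = 0 := by
  have hzero : newtonPolynomial β = 0 := by
    refine eq_zero_of_degree_lt_of_eval_finset_eq_zero (S.map Nat.castEmbedding) ?_ ?_
    · rw [Finset.card_map]
      exact degree_newtonPolynomial_lt hβ
    · simpa using hS
  funext j
  exact eq_zero_of_eval_newtonPolynomial_of_lt (m := n) (fun s _ => by rw [hzero, eval_zero]) j j.2

lemma eval_newtonPolynomial_eq_zero_iff {S : Finset ℕ}
    (hS : ∀ s ∈ S, (newtonPolynomial β).eval (s : ℂ) = 0)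
    (hβ : ∀ j : Fin n, S.card < j → β j = 0) (hβ0 : β ≠ 0) {s : ℕ} :
    (newtonPolynomial β).eval (s : ℂ) = 0 ↔ s ∈ S := by
  refine ⟨fun hs => by_contra fun hsS => hβ0 ?_, hS s⟩
  refine eq_zero_of_eval_newtonPolynomial (insert s S) (Finset.forall_mem_insert _ _ _ |>.2
    ⟨hs, hS⟩) fun j hj => hβ j ?_
  rwa [Finset.card_insert_of_notMem hsS] at hj

end NewtonPolynomial

/-- The coefficients of the part of degree `h` of the operator `∑ b j ∂ ^ j`: the `j`-th one is
the coefficient of `x ^ (h + j) ∂ ^ j`. -/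
def homogeneousCoeff {N : ℕ} (b : Fin (N + 1) → ℂ[X]) (h : ℤ) (j : Fin (N + 1)) : ℂ :=
  if 0 ≤ h + j then (b j).coeff (h + j).toNat else 0

/-- The polynomial by whose value at `s` the part of degree `h` of `∑ b j ∂ ^ j` multiplies
`x ^ s`. -/
def indicialPolynomial {N : ℕ} (b : Fin (N + 1) → ℂ[X]) (h : ℤ) : ℂ[X] :=
  newtonPolynomial (homogeneousCoeff b h)

/-- The operator `∑ c j ∂ ^ j` written in the coordinate centred at `z`. -/
def recenter {N : ℕ} (z : ℂ) (c : Fin (N + 1) → ℂ[X]) (j : Fin (N + 1)) : ℂ[X] :=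
  taylor z (c j)

/-- The function `∑ c j ∂ ^ j f`. -/
def applyOperator {N : ℕ} (c : Fin (N + 1) → ℂ[X]) (f : ℂ → ℂ) (x : ℂ) : ℂ :=
  ∑ j, (c j).eval x * iteratedDeriv (j : ℕ) f x

/-- The space of entire functions annihilated by `∑ c j ∂ ^ j`. -/
def solutionSpace {N : ℕ} (c : Fin (N + 1) → ℂ[X]) : Submodule ℂ (ℂ → ℂ) where
  carrier := {f | Differentiable ℂ f ∧ ∀ x, applyOperator c f x = 0}
  zero_mem' := ⟨differentiable_const 0, fun x => by simp [applyOperator, iteratedDeriv_const_zero]⟩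
  add_mem' {f g} hf hg := ⟨hf.1.add hg.1, fun x => by
    have h : ∀ j : ℕ, iteratedDeriv j (f + g) x = iteratedDeriv j f x + iteratedDeriv j g x :=
      fun j => iteratedDeriv_add hf.1.contDiff.contDiffAt hg.1.contDiff.contDiffAt
    simpa only [applyOperator, h, mul_add, Finset.sum_add_distrib, add_zero]
      using congrArg₂ (· + ·) (hf.2 x) (hg.2 x)⟩
  smul_mem' a f hf := ⟨hf.1.const_smul a, fun x => by
    have h : ∀ j : ℕ, iteratedDeriv j (a • f) x = a * iteratedDeriv j f x :=
      fun j => iteratedDeriv_const_smul hf.1.contDiff.contDiffAt a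
    simpa only [applyOperator, h, mul_left_comm _ a, ← Finset.mul_sum, mul_zero]
      using congrArg (a * ·) (hf.2 x)⟩

lemma solutionSpace_le_entireFunctions {N : ℕ} (c : Fin (N + 1) → ℂ[X]) :
    solutionSpace c ≤ entireFunctions :=
  fun _ hf => hf.1

section HomogeneousParts

variable {N : ℕ} {b : Fin (N + 1) → ℂ[X]}

lemma homogeneousCoeff_natCast_sub (i : ℕ) (j : Fin (N + 1)) :
    homogeneousCoeff b ((i : ℤ) - j) j = (b j).coeff i := by
  simp [homogeneousCoeff]

lemma coeff_eq_zero_of_homogeneousCoeff_eq_zero {i : ℕ} {j : Fin (N + 1)}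
    (h : homogeneousCoeff b ((i : ℤ) - j) = 0) : (b j).coeff i = 0 := by
  rw [← homogeneousCoeff_natCast_sub, h, Pi.zero_apply]

lemma homogeneousCoeff_eq_zero {h : ℤ} {j : Fin (N + 1)}
    (hj : h + j < 0 ∨ ((b j).natDegree : ℤ) < h + j) : homogeneousCoeff b h j = 0 := by
  unfold homogeneousCoeff
  split_ifs with h0
  · exact coeff_eq_zero_of_natDegree_lt (by omega)
  · rfl

lemma exists_homogeneousCoeff_ne_zero (hb : b ≠ 0) : ∃ h : ℤ, homogeneousCoeff b h ≠ 0 := by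
  obtain ⟨j, hj⟩ := Function.ne_iff.1 hb
  refine ⟨(b j).natDegree - j, fun h => hj ?_⟩
  exact leadingCoeff_eq_zero.1 (coeff_eq_zero_of_homogeneousCoeff_eq_zero h)

lemma exists_lowest_homogeneousCoeff (hb : b ≠ 0) :
    ∃ h : ℤ, homogeneousCoeff b h ≠ 0 ∧ ∀ g < h, homogeneousCoeff b g = 0 := by
  have hbdd : ∀ h : ℤ, homogeneousCoeff b h ≠ 0 → -(N : ℤ) ≤ h := fun h hh => by
    by_contra! hlt
    exact hh (funext fun j => homogeneousCoeff_eq_zero (by omega))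
  obtain ⟨h, hne, hmin⟩ := Int.exists_least_of_bdd ⟨_, hbdd⟩ (exists_homogeneousCoeff_ne_zero hb)
  exact ⟨h, hne, fun g hg => by_contra fun hg0 => (hmin g hg0).not_gt hg⟩

lemma exists_highest_homogeneousCoeff (hb : b ≠ 0) :
    ∃ h : ℤ, homogeneousCoeff b h ≠ 0 ∧ ∀ g > h, homogeneousCoeff b g = 0 := by
  have hbdd : ∀ h : ℤ, homogeneousCoeff b h ≠ 0 →
      h ≤ (Finset.univ.sup fun j => (b j).natDegree : ℕ) := fun h hh => by
    by_contra! hlt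
    refine hh (funext fun j => homogeneousCoeff_eq_zero (Or.inr ?_))
    have hle : (b j).natDegree ≤ Finset.univ.sup fun j => (b j).natDegree :=
      Finset.le_sup (f := fun j => (b j).natDegree) (Finset.mem_univ j)
    omega
  obtain ⟨h, hne, hmax⟩ :=
    Int.exists_greatest_of_bdd ⟨_, hbdd⟩ (exists_homogeneousCoeff_ne_zero hb)
  exact ⟨h, hne, fun g hg => by_contra fun hg0 => (hmax g hg0).not_gt hg⟩

lemma exists_eval_eq_zpow_mul {h : ℤ} (hb : ∀ g < h, homogeneousCoeff b g = 0)
    (j : Fin (N + 1)) : ∃ v : ℂ → ℂ, Continuous v ∧ v 0 = homogeneousCoeff b h j ∧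
      ∀ x ≠ 0, (b j).eval x = x ^ (h + j) * v x := by
  rcases le_or_gt 0 (h + j) with hj | hj
  · obtain ⟨k, hk⟩ := Int.eq_ofNat_of_zero_le hj
    obtain ⟨q, hq⟩ : X ^ k ∣ b j := X_pow_dvd_iff.2 fun i hi =>
      coeff_eq_zero_of_homogeneousCoeff_eq_zero (hb _ (by omega))
    refine ⟨fun x => q.eval x, by fun_prop, ?_, fun x _ => by simp [hq, hk]⟩
    rw [show h = (k : ℤ) - j by omega, homogeneousCoeff_natCast_sub, hq,
      coeff_X_pow_mul', if_pos le_rfl, Nat.sub_self, coeff_zero_eq_eval_zero]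
  · refine ⟨fun x => x ^ (-(h + j)).toNat * (b j).eval x, by fun_prop, ?_, fun x hx => ?_⟩ <;>
      dsimp only
    · simp only [homogeneousCoeff_eq_zero (Or.inl hj), zero_pow (by omega : (-(h + j)).toNat ≠ 0),
        zero_mul]
    · rw [← zpow_natCast, Int.toNat_of_nonneg (by omega), ← mul_assoc, ← zpow_add₀ hx,
        add_neg_cancel, zpow_zero, one_mul]

end HomogeneousParts

section LocalTheory

variable {N : ℕ} {c : Fin (N + 1) → ℂ[X]} {z : ℂ} {h : ℤ}

lemma eval_indicialPolynomial_eq_zero (hc : ∀ g < h, homogeneousCoeff (recenter z c) g = 0)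
    {f : ℂ → ℂ} (hf : f ∈ solutionSpace c) {s : ℕ}
    (hs : meromorphicOrderAt f z = ((s : ℤ) : WithTop ℤ)) :
    (indicialPolynomial (recenter z c) h).eval (s : ℂ) = 0 := by
  obtain ⟨u, hu, huz, hfu⟩ := exists_eq_pow_mul hf.1 hs
  choose v hv hvz hfv using fun j => exists_iteratedDeriv_eq_zpow_mul hu hfu j
  choose w hw hw0 hcw using exists_eval_eq_zpow_mul hc
  have hterm : ∀ x ≠ z, ∀ j : Fin (N + 1), (c j).eval x * iteratedDeriv (j : ℕ) f x =
      (x - z) ^ (h + s) * (w j (x - z) * v j x) := by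
    intro x hx j
    have hxz : x - z ≠ 0 := sub_ne_zero.2 hx
    rw [← taylor_eval_sub z, hfv j x hx, show taylor z (c j) = recenter z c j from rfl,
      hcw j _ hxz, show h + (s : ℤ) = (h + j) + (s - j) by ring, zpow_add₀ hxz (h + (j : ℤ))]
    exact mul_mul_mul_comm _ _ _ _
  have hzero : ∀ x ≠ z, ∑ j, w j (x - z) * v j x = 0 := by
    intro x hx
    have hfx := hf.2 x
    simp only [applyOperator, hterm x hx, ← Finset.mul_sum] at hfx
    exact (mul_eq_zero.1 hfx).resolve_left (zpow_ne_zero _ (sub_ne_zero.2 hx))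
  have hcont : Continuous fun x => ∑ j, w j (x - z) * v j x :=
    continuous_finsetSum _ fun j _ =>
      ((hw j).comp (continuous_id.sub continuous_const)).mul (hv j).continuous
  have hz := congrFun (hcont.ext_on (dense_compl_singleton z) continuous_const hzero) z
  simp only [sub_self, hw0, hvz, ← mul_assoc, ← Finset.sum_mul] at hz
  rw [indicialPolynomial, eval_natCast_newtonPolynomial]
  exact (mul_eq_zero.1 hz).resolve_right huz

lemma exists_le_eval_ne_zero {W : Submodule ℂ (ℂ → ℂ)} (hW : W ≤ solutionSpace c) {m : ℕ}
    (hm : ∀ s < m, (s : ℤ) ∈ exponents W z) (hz : ∃ j, (c j).eval z ≠ 0) :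
    ∃ j : Fin (N + 1), m ≤ j ∧ (c j).eval z ≠ 0 := by
  by_contra! hhigh
  obtain ⟨j, hj, hmax⟩ := Set.Finite.exists_maximal (s := {j | (c j).eval z ≠ 0})
    (Set.toFinite _) hz
  have hjm : (j : ℕ) < m := by
    by_contra! hle
    exact hj (hhigh j hle)
  obtain ⟨f, hf, hord⟩ := hm j hjm
  obtain ⟨hlow, hne⟩ := (meromorphicOrderAt_eq_natCast_iff (hW hf).1).1 hord
  have hfz := (hW hf).2 z
  rw [applyOperator, Finset.sum_eq_single j] at hfz
  · exact mul_ne_zero hj hne hfz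
  · intro i _ hij
    rcases lt_or_gt_of_ne hij with hlt | hgt
    · rw [hlow i hlt, mul_zero]
    · rw [by_contra fun hi => hgt.not_ge (hmax hi hgt.le), zero_mul]
  · simp

lemma le_neg_of_eval_ne_zero (hc : ∀ g < h, homogeneousCoeff (recenter z c) g = 0)
    {j : Fin (N + 1)} (hj : (c j).eval z ≠ 0) : h ≤ -(j : ℤ) := by
  by_contra! hlt
  refine hj ?_
  rw [← taylor_coeff_zero]
  exact coeff_eq_zero_of_homogeneousCoeff_eq_zero (b := recenter z c) (hc _ (by omega))

variable {W : Submodule ℂ (ℂ → ℂ)} [FiniteDimensional ℂ W]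

lemma eval_indicialPolynomial_eq_zero_iff (hW : W ≤ solutionSpace c)
    (hdim : Module.finrank ℂ W = N) (hc : ∀ g < h, homogeneousCoeff (recenter z c) g = 0)
    (hh : homogeneousCoeff (recenter z c) h ≠ 0) {s : ℕ} :
    (indicialPolynomial (recenter z c) h).eval (s : ℂ) = 0 ↔ (s : ℤ) ∈ exponents W z := by
  obtain ⟨S, hcard, hS⟩ :=
    exists_finset_exponents (hW.trans (solutionSpace_le_entireFunctions c)) z
  rw [← hS]
  refine eval_newtonPolynomial_eq_zero_iff (fun s hs => ?_) (fun j hj => by omega) hh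
  obtain ⟨f, hf, hfs⟩ := (hS s).1 hs
  exact eval_indicialPolynomial_eq_zero hc (hW hf) hfs

lemma homogeneousCoeff_last_ne_zero (hW : W ≤ solutionSpace c)
    (hdim : Module.finrank ℂ W = N) (hc : ∀ g < h, homogeneousCoeff (recenter z c) g = 0)
    (hh : homogeneousCoeff (recenter z c) h ≠ 0) :
    homogeneousCoeff (recenter z c) h (Fin.last N) ≠ 0 := by
  obtain ⟨S, hcard, hS⟩ :=
    exists_finset_exponents (hW.trans (solutionSpace_le_entireFunctions c)) z
  refine fun hlast => hh (eq_zero_of_eval_newtonPolynomial S (fun s hs => ?_) fun j hj => ?_)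
  · exact (eval_indicialPolynomial_eq_zero_iff hW hdim hc hh).2 ((hS s).1 hs)
  · rwa [show j = Fin.last N from Fin.ext (by rw [Fin.val_last]; omega)]

lemma rootMultiplicity_eq_of_homogeneousCoeff_ne_zero {j : Fin (N + 1)}
    (hc : ∀ g < h, homogeneousCoeff (recenter z c) g = 0)
    (hj : homogeneousCoeff (recenter z c) h j ≠ 0) :
    ((c j).rootMultiplicity z : ℤ) = h + j := by
  obtain ⟨i, hi⟩ : ∃ i : ℕ, h = (i : ℤ) - j := by
    have hnonneg : 0 ≤ h + j := by
      by_contra! hlt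
      exact hj (homogeneousCoeff_eq_zero (Or.inl hlt))
    exact ⟨(h + j).toNat, by omega⟩
  rw [hi, homogeneousCoeff_natCast_sub] at hj
  rw [rootMultiplicity_eq_natTrailingDegree, hi, sub_add_cancel, Nat.cast_inj]
  refine le_antisymm (natTrailingDegree_le_of_ne_zero hj)
    (le_natTrailingDegree (fun h0 => hj ?_) fun l hl => ?_)
  · rw [show recenter z c j = (c j).comp (X + C z) from rfl, h0, coeff_zero]
  · exact coeff_eq_zero_of_homogeneousCoeff_eq_zero (b := recenter z c) (hc _ (by omega))

lemma recenter_ne_zero (hc : c ≠ 0) : recenter z c ≠ 0 := by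
  obtain ⟨j, hj⟩ := Function.ne_iff.1 hc
  exact Function.ne_iff.2 ⟨j, (taylor_eq_zero z (c j)).not.2 hj⟩

lemma last_ne_zero (hW : W ≤ solutionSpace c) (hdim : Module.finrank ℂ W = N) (hc : c ≠ 0) :
    c (Fin.last N) ≠ 0 := by
  obtain ⟨h, hh, hmin⟩ := exists_lowest_homogeneousCoeff (recenter_ne_zero (z := 0) hc)
  intro h0
  refine homogeneousCoeff_last_ne_zero hW hdim hmin hh ?_
  simp [homogeneousCoeff, recenter, h0]

lemma rootMultiplicity_last_eq (hW : W ≤ solutionSpace c) (hdim : Module.finrank ℂ W = N)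
    (hz : ∃ j, (c j).eval z ≠ 0) {k : ℕ} (hk : k ≤ N) {e : Fin k → ℕ} (he : ∀ b, 0 < e b)
    (hexp : exponents W z = shiftedExponents N k e) :
    (c (Fin.last N)).rootMultiplicity z = k := by
  have hlow : ∀ s < N - k, (s : ℤ) ∈ exponents W z := fun s hs =>
    hexp ▸ Or.inl ⟨by omega, by omega⟩
  have hgap : ((N - k : ℕ) : ℤ) ∉ exponents W z := by
    rw [hexp]
    rintro (⟨-, hlt⟩ | ⟨b, hb⟩)
    · omega
    · have := he b
      dsimp only at hb
      omega
  obtain ⟨j, hNj, hj⟩ := exists_le_eval_ne_zero hW hlow hz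
  obtain ⟨h, hh, hmin⟩ := exists_lowest_homogeneousCoeff
    (recenter_ne_zero (z := z) fun h0 : c = 0 => hj (by rw [h0, Pi.zero_apply, eval_zero]))
  have hle : h ≤ -(j : ℤ) := le_neg_of_eval_ne_zero hmin hj
  have hge : 0 ≤ h + (N - k : ℕ) := by
    by_contra! hlt
    refine hgap ((eval_indicialPolynomial_eq_zero_iff hW hdim hmin hh).1 ?_)
    exact eval_newtonPolynomial_of_lt fun i hi => homogeneousCoeff_eq_zero (Or.inl (by omega))
  have hroot := rootMultiplicity_eq_of_homogeneousCoeff_ne_zero hmin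
    (homogeneousCoeff_last_ne_zero hW hdim hmin hh)
  rw [Fin.val_last] at hroot
  omega

lemma exponents_eq_of_eval_last_ne_zero (hW : W ≤ solutionSpace c)
    (hdim : Module.finrank ℂ W = N) (hz : (c (Fin.last N)).eval z ≠ 0) :
    exponents W z = Set.Ico (0 : ℤ) N := by
  have hmin : ∀ g < -(N : ℤ), homogeneousCoeff (recenter z c) g = 0 := fun g hg =>
    funext fun j => homogeneousCoeff_eq_zero (by omega)
  have hcoeff : homogeneousCoeff (recenter z c) (-N) (Fin.last N) = (c (Fin.last N)).eval z := by
    simp [homogeneousCoeff, recenter, taylor_coeff_zero]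
  have hiff : ∀ s : ℕ, (s : ℤ) ∈ exponents W z ↔ s < N := fun s => by
    rw [← eval_indicialPolynomial_eq_zero_iff hW hdim hmin
      (fun h0 => hz (by rw [← hcoeff, h0, Pi.zero_apply])), indicialPolynomial,
      eval_natCast_newtonPolynomial, Finset.sum_eq_single (Fin.last N), hcoeff]
    · simp [hz]
    · intro j _ hj
      rw [homogeneousCoeff_eq_zero (Or.inl _), zero_mul]
      have := Fin.val_lt_last hj
      omega
    · simp
  ext s
  constructor
  · intro hs
    obtain ⟨n, rfl⟩ :=
      exists_natCast_eq_of_mem_exponents (hW.trans (solutionSpace_le_entireFunctions c)) hs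
    exact ⟨by omega, by exact_mod_cast (hiff n).1 hs⟩
  · rintro ⟨h0, hN⟩
    obtain ⟨n, rfl⟩ := Int.eq_ofNat_of_zero_le h0
    exact (hiff n).2 (by exact_mod_cast hN)

end LocalTheory

/-- The coefficients of the operator obtained from `∑ c j ∂ ^ j` by exchanging `x` and `∂`: the
`i`-th one collects the coefficients of `x ^ i`.  Terms of degree more than `M` in `x` are lost. -/
def dualOperator {N : ℕ} (M : ℕ) (c : Fin (N + 1) → ℂ[X]) (i : Fin (M + 1)) : ℂ[X] :=
  ∑ j : Fin (N + 1), monomial (j : ℕ) ((c j).coeff i)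

section DualOperator

variable {N M : ℕ} {c : Fin (N + 1) → ℂ[X]}

lemma coeff_dualOperator (c : Fin (N + 1) → ℂ[X]) (i : Fin (M + 1)) (j : Fin (N + 1)) :
    (dualOperator M c i).coeff j = (c j).coeff i := by
  simp [dualOperator, coeff_monomial, Fin.val_inj]

lemma natDegree_dualOperator_le (c : Fin (N + 1) → ℂ[X]) (i : Fin (M + 1)) :
    (dualOperator M c i).natDegree ≤ N :=
  natDegree_sum_le_of_forall_le _ _ fun j _ => (natDegree_monomial_le _).trans j.is_le

lemma dualOperator_dualOperator (hc : ∀ j, (c j).natDegree ≤ M) :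
    dualOperator N (dualOperator M c) = c := by
  refine funext fun j => ext_iff_natDegree_le (natDegree_dualOperator_le _ j) (hc j) |>.2
    fun i hi => ?_
  lift i to Fin (M + 1) using Nat.lt_succ_of_le hi
  rw [coeff_dualOperator, coeff_dualOperator]

lemma sum_mul_pow_apply_eq (hc : ∀ j, (c j).natDegree ≤ M) (L : Module.End ℂ ℂ[X]) (p : ℂ[X]) :
    ∑ j, c j * (L ^ (j : ℕ)) p =
      ∑ i : Fin (M + 1), X ^ (i : ℕ) * aeval L (dualOperator M c i) p := by
  simp only [dualOperator, map_sum, aeval_monomial, LinearMap.sum_apply, Finset.mul_sum]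
  rw [Finset.sum_comm]
  refine Finset.sum_congr rfl fun j _ => ?_
  conv_lhs => rw [as_sum_range_C_mul_X_pow' (c j) (Nat.lt_succ_of_le (hc j)), Finset.sum_range,
    Finset.sum_mul]
  refine Finset.sum_congr rfl fun i _ => ?_
  rw [Module.End.mul_apply, Module.algebraMap_end_apply, smul_eq_C_mul]
  ring

lemma homogeneousCoeff_eq_sum (hc : ∀ j, (c j).natDegree ≤ M) (k : ℤ) (j : Fin (N + 1)) :
    homogeneousCoeff c k j = ∑ i : Fin (M + 1), if (i : ℤ) = k + j then (c j).coeff i else 0 := by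
  by_cases h : ∃ i : Fin (M + 1), (i : ℤ) = k + j
  · obtain ⟨i, hi⟩ := h
    rw [Finset.sum_eq_single i, if_pos hi, eq_sub_of_add_eq hi.symm, homogeneousCoeff_natCast_sub]
    · intro l _ hl
      rw [if_neg]
      intro hl'
      exact hl (Fin.ext (by omega))
    · simp
  · rw [Finset.sum_eq_zero fun i _ => if_neg fun hi => h ⟨i, hi⟩]
    refine homogeneousCoeff_eq_zero ?_
    by_contra! hk
    have := hc j
    exact h ⟨⟨(k + j).toNat, by omega⟩, by simp [hk.1]⟩

lemma homogeneousCoeff_dualOperator (c : Fin (N + 1) → ℂ[X]) (k : ℤ) (i : Fin (M + 1)) :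
    homogeneousCoeff (dualOperator M c) (-k) i =
      ∑ j : Fin (N + 1), if (i : ℤ) = k + j then (c j).coeff i else 0 := by
  rw [homogeneousCoeff_eq_sum (natDegree_dualOperator_le c)]
  refine Finset.sum_congr rfl fun j _ => ?_
  simp only [coeff_dualOperator, eq_neg_add_iff_add_eq, eq_comm (a := (i : ℤ))]

lemma homogeneousCoeff_dualOperator_eq_zero {k : ℤ} (hk : homogeneousCoeff c k = 0) :
    homogeneousCoeff (dualOperator M c) (-k) = 0 := by
  funext i
  rw [homogeneousCoeff_dualOperator]
  refine Finset.sum_eq_zero fun j _ => ite_eq_right_iff.2 fun hij => ?_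
  exact coeff_eq_zero_of_homogeneousCoeff_eq_zero (by rw [hij, add_sub_cancel_right, hk])

lemma eval_indicialPolynomial_dualOperator (hc : ∀ j, (c j).natDegree ≤ M) (d s : ℕ) :
    (indicialPolynomial (dualOperator M c) (-d)).eval ((s + d : ℕ) : ℂ) =
      (s + d).descFactorial d * (indicialPolynomial c d).eval (s : ℂ) := by
  simp only [indicialPolynomial, eval_natCast_newtonPolynomial, homogeneousCoeff_dualOperator,
    homogeneousCoeff_eq_sum hc, Finset.sum_mul, Finset.mul_sum]
  rw [Finset.sum_comm]
  refine Finset.sum_congr rfl fun j _ => Finset.sum_congr rfl fun i _ => ?_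
  split_ifs with hij
  · have hfac := Nat.descFactorial_mul_descFactorial (n := s + d) (k := d) (m := i) (by omega)
    rw [← hfac, Nat.add_sub_cancel, show (i : ℕ) - d = j by omega]
    push_cast
    ring
  · ring

end DualOperator

/-- The endomorphism `p ↦ p' + lam p` of the space of polynomials; it describes the derivation of
the functions `p exp (lam x)`. -/
def twistedDerivative (lam : ℂ) : Module.End ℂ ℂ[X] :=
  derivative + algebraMap ℂ (Module.End ℂ ℂ[X]) lam

lemma aeval_twistedDerivative (lam : ℂ) (q : ℂ[X]) :
    aeval (twistedDerivative lam) q = aeval (derivative : Module.End ℂ ℂ[X]) (taylor lam q) := by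
  rw [taylor_apply, aeval_comp]
  simp [twistedDerivative]

/-- The function `p exp (lam x)`. -/
def quasiPolynomial (p : ℂ[X]) (lam : ℂ) (x : ℂ) : ℂ :=
  p.eval x * Complex.exp (lam * x)

/-- The operator `exp (- lam x) ∘ ∑ c j ∂ ^ j ∘ exp (lam x)`, for polynomials `c j` of degree at
most `M`.  Conjugation by exponentials becomes a translation when `x` and `∂` are exchanged. -/
def twist {N : ℕ} (M : ℕ) (lam : ℂ) (c : Fin (N + 1) → ℂ[X]) : Fin (N + 1) → ℂ[X] :=
  dualOperator N (recenter lam (dualOperator M c))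

section QuasiPolynomial

variable {N M : ℕ} {c : Fin (N + 1) → ℂ[X]} {p : ℂ[X]} {lam : ℂ}

lemma differentiable_quasiPolynomial (p : ℂ[X]) (lam : ℂ) :
    Differentiable ℂ (quasiPolynomial p lam) := by
  unfold quasiPolynomial
  fun_prop

lemma deriv_quasiPolynomial (p : ℂ[X]) (lam : ℂ) :
    deriv (quasiPolynomial p lam) = quasiPolynomial (twistedDerivative lam p) lam := by
  funext x
  have h := (p.hasDerivAt x).mul (((hasDerivAt_id x).const_mul lam).cexp)
  refine h.deriv.trans ?_
  simp [quasiPolynomial, twistedDerivative]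
  ring

lemma iteratedDeriv_quasiPolynomial (p : ℂ[X]) (lam : ℂ) (j : ℕ) :
    iteratedDeriv j (quasiPolynomial p lam) =
      quasiPolynomial ((twistedDerivative lam ^ j) p) lam := by
  induction j with
  | zero => simp
  | succ j ih =>
    rw [iteratedDeriv_succ, ih, pow_succ', Module.End.mul_apply, deriv_quasiPolynomial]

lemma quasiPolynomial_mem_solutionSpace_iff :
    quasiPolynomial p lam ∈ solutionSpace c ↔
      ∑ j, c j * (twistedDerivative lam ^ (j : ℕ)) p = 0 := by
  have happly : ∀ x, applyOperator c (quasiPolynomial p lam) x =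
      (∑ j, c j * (twistedDerivative lam ^ (j : ℕ)) p).eval x * Complex.exp (lam * x) := fun x => by
    simp only [applyOperator, iteratedDeriv_quasiPolynomial, quasiPolynomial, ← mul_assoc,
      ← Finset.sum_mul, eval_finsetSum, eval_mul]
  refine ⟨fun h => Polynomial.funext fun x => ?_, fun h => ⟨differentiable_quasiPolynomial p lam,
    fun x => by rw [happly, h, eval_zero, zero_mul]⟩⟩
  rw [eval_zero]
  exact (mul_eq_zero.1 ((happly x).symm.trans (h.2 x))).resolve_right (Complex.exp_ne_zero _)

lemma natDegree_twist_le (j : Fin (N + 1)) : (twist M lam c j).natDegree ≤ M :=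
  natDegree_dualOperator_le _ j

lemma natDegree_recenter_le {b : Fin (M + 1) → ℂ[X]} (hb : ∀ i, (b i).natDegree ≤ N)
    (i : Fin (M + 1)) : (recenter lam b i).natDegree ≤ N := by
  rw [recenter, natDegree_taylor]
  exact hb i

lemma dualOperator_twist (c : Fin (N + 1) → ℂ[X]) :
    dualOperator M (twist M lam c) = recenter lam (dualOperator M c) :=
  dualOperator_dualOperator (natDegree_recenter_le (natDegree_dualOperator_le c))

lemma sum_mul_twistedDerivative_pow (hc : ∀ j, (c j).natDegree ≤ M) :
    ∑ j, c j * (twistedDerivative lam ^ (j : ℕ)) p = ∑ j, twist M lam c j * derivative^[j] p := by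
  simp only [← Module.End.pow_apply]
  rw [sum_mul_pow_apply_eq hc, sum_mul_pow_apply_eq natDegree_twist_le, dualOperator_twist]
  simp only [aeval_twistedDerivative, recenter]

end QuasiPolynomial

section Infinity

lemma coeff_mul_iterate_derivative {q p : ℂ[X]} {d j : ℕ} (hq : q.natDegree ≤ d)
    (hj : j ≤ p.natDegree) : (q * derivative^[j] p).coeff (d + (p.natDegree - j)) =
      q.coeff d * p.natDegree.descFactorial j * p.leadingCoeff := by
  rw [coeff_mul_add_eq_of_natDegree_le hq (natDegree_iterate_derivative p j),
    coeff_iterate_derivative, Nat.sub_add_cancel hj, nsmul_eq_mul, mul_assoc, leadingCoeff]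

lemma eval_indicialPolynomial_natDegree {N : ℕ} {b : Fin (N + 1) → ℂ[X]} {k : ℤ}
    (hb : ∀ g > k, homogeneousCoeff b g = 0) {p : ℂ[X]} (hp : p ≠ 0)
    (hbp : ∑ j, b j * derivative^[j] p = 0) :
    (indicialPolynomial b k).eval (p.natDegree : ℂ) = 0 := by
  set s := p.natDegree
  rcases lt_or_ge (s + k) 0 with hneg | hnonneg
  · exact eval_newtonPolynomial_of_lt fun j hj => homogeneousCoeff_eq_zero (Or.inl (by omega))
  have hterm : ∀ j : Fin (N + 1), (b j * derivative^[j] p).coeff (s + k).toNat =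
      homogeneousCoeff b k j * s.descFactorial j * p.leadingCoeff := by
    intro j
    have hcoeff : ∀ i : ℕ, k + j < i → (b j).coeff i = 0 := fun i hi =>
      coeff_eq_zero_of_homogeneousCoeff_eq_zero (hb _ (by omega))
    rcases lt_or_ge s j with hj | hj
    · rw [iterate_derivative_eq_zero hj, Nat.descFactorial_eq_zero_iff_lt.2 hj]
      simp
    rcases lt_or_ge (k + j) 0 with hkj | hkj
    · rw [homogeneousCoeff_eq_zero (Or.inl hkj), show b j = 0 from
        ext fun i => hcoeff i (by omega)]
      simp
    · obtain ⟨d, hd⟩ := Int.eq_ofNat_of_zero_le hkj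
      rw [show (s + k).toNat = d + (s - j) by omega, coeff_mul_iterate_derivative
        (natDegree_le_iff_coeff_eq_zero.2 fun i hi => hcoeff i (by omega)) hj,
        eq_sub_of_add_eq hd, homogeneousCoeff_natCast_sub]
  have hsum := congrArg (fun q => q.coeff (s + k).toNat) hbp
  simp only [finsetSum_coeff, hterm, ← Finset.sum_mul, coeff_zero] at hsum
  rw [indicialPolynomial, eval_natCast_newtonPolynomial]
  exact (mul_eq_zero.1 hsum).resolve_right (leadingCoeff_ne_zero.2 hp)

/-- The degrees of the polynomials `p` such that `p exp (lam x)` is annihilated by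
`∑ c j ∂ ^ j`. -/
def quasiPolynomialDegrees {N : ℕ} (c : Fin (N + 1) → ℂ[X]) (lam : ℂ) : Set ℕ :=
  {s | ∃ p ≠ 0, p.natDegree = s ∧ quasiPolynomial p lam ∈ solutionSpace c}

variable {N K : ℕ} {c : Fin (N + 1) → ℂ[X]} {lam : ℂ} {S : Finset ℕ}

lemma eval_indicialPolynomial_twist_eq_zero (hc : ∀ j, (c j).natDegree ≤ K)
    (hS : ↑S ⊆ quasiPolynomialDegrees c lam) {k : ℤ}
    (hk : ∀ g > k, homogeneousCoeff (twist K lam c) g = 0) {s : ℕ} (hs : s ∈ S) :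
    (indicialPolynomial (twist K lam c) k).eval (s : ℂ) = 0 := by
  obtain ⟨p, hp, rfl, hsol⟩ := hS hs
  refine eval_indicialPolynomial_natDegree hk hp ?_
  rw [← sum_mul_twistedDerivative_pow hc]
  exact quasiPolynomial_mem_solutionSpace_iff.1 hsol

lemma homogeneousCoeff_twist_eq_zero (hc : ∀ j, (c j).natDegree ≤ K)
    (hS : ↑S ⊆ quasiPolynomialDegrees c lam) {g : ℤ} (hg : (K : ℤ) - S.card < g) :
    homogeneousCoeff (twist K lam c) g = 0 := by
  by_contra hne
  obtain ⟨k, hk, hmax⟩ := exists_highest_homogeneousCoeff (b := twist K lam c) fun h0 => hne <| by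
    funext j
    simp [homogeneousCoeff, h0]
  have hgk : g ≤ k := by
    by_contra! hlt
    exact hne (hmax g hlt)
  refine hk (eq_zero_of_eval_newtonPolynomial S (fun s hs =>
    eval_indicialPolynomial_twist_eq_zero hc hS hmax hs) fun j hj => ?_)
  have := natDegree_twist_le (M := K) (lam := lam) (c := c) j
  exact homogeneousCoeff_eq_zero (Or.inr (by omega))

lemma homogeneousCoeff_recenter_dualOperator_eq_zero (hc : ∀ j, (c j).natDegree ≤ K)
    (hS : ↑S ⊆ quasiPolynomialDegrees c lam) {g : ℤ} (hg : g < S.card - (K : ℤ)) :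
    homogeneousCoeff (recenter lam (dualOperator K c)) g = 0 := by
  rw [← dualOperator_twist, ← neg_neg g]
  exact homogeneousCoeff_dualOperator_eq_zero (homogeneousCoeff_twist_eq_zero hc hS (by omega))

lemma X_sub_C_pow_dvd_dualOperator_last (hc : ∀ j, (c j).natDegree ≤ K)
    (hS : ↑S ⊆ quasiPolynomialDegrees c lam) :
    (X - C lam) ^ S.card ∣ dualOperator K c (Fin.last K) := by
  refine X_sub_C_pow_dvd_iff.2 (X_pow_dvd_iff.2 fun i hi => ?_)
  refine coeff_eq_zero_of_homogeneousCoeff_eq_zero (b := recenter lam (dualOperator K c)) ?_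
  exact homogeneousCoeff_recenter_dualOperator_eq_zero hc hS (by rw [Fin.val_last]; omega)

lemma coeff_taylor_rootMultiplicity_ne_zero {q : ℂ[X]} (hq : q ≠ 0) (z : ℂ) :
    (taylor z q).coeff (q.rootMultiplicity z) ≠ 0 := by
  rw [rootMultiplicity_eq_natTrailingDegree, ← taylor_apply]
  exact trailingCoeff_eq_zero.not.2 ((taylor_eq_zero z q).not.2 hq)

lemma homogeneousCoeff_recenter_dualOperator_ne_zero (hK : dualOperator K c (Fin.last K) ≠ 0)
    (hroot : (dualOperator K c (Fin.last K)).rootMultiplicity lam = S.card) :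
    homogeneousCoeff (recenter lam (dualOperator K c)) (S.card - K) ≠ 0 := by
  refine Function.ne_iff.2 ⟨Fin.last K, ?_⟩
  have := coeff_taylor_rootMultiplicity_ne_zero hK lam
  rw [hroot] at this
  simpa [homogeneousCoeff, recenter] using this

lemma eval_indicialPolynomial_twist_eq_zero_iff (hc : ∀ j, (c j).natDegree ≤ K)
    (hS : ↑S ⊆ quasiPolynomialDegrees c lam) (hK : dualOperator K c (Fin.last K) ≠ 0)
    (hroot : (dualOperator K c (Fin.last K)).rootMultiplicity lam = S.card) {s : ℕ} :
    (indicialPolynomial (twist K lam c) (K - S.card)).eval (s : ℂ) = 0 ↔ s ∈ S := by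
  refine eval_newtonPolynomial_eq_zero_iff (fun s hs => eval_indicialPolynomial_twist_eq_zero hc hS
    (fun g hg => homogeneousCoeff_twist_eq_zero hc hS hg) hs) (fun j hj => ?_) fun h0 => ?_
  · have := natDegree_twist_le (M := K) (lam := lam) (c := c) j
    exact homogeneousCoeff_eq_zero (Or.inr (by omega))
  · refine homogeneousCoeff_recenter_dualOperator_ne_zero hK hroot ?_
    rw [← dualOperator_twist, ← neg_sub]
    exact homogeneousCoeff_dualOperator_eq_zero h0

lemma exists_eval_dualOperator_ne_zero (hc : ∀ j, (c j).natDegree ≤ K)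
    (hS : ↑S ⊆ quasiPolynomialDegrees c lam) (hK : dualOperator K c (Fin.last K) ≠ 0)
    (hroot : (dualOperator K c (Fin.last K)).rootMultiplicity lam = S.card) (h0 : 0 ∉ S) :
    ∃ i : Fin (K + 1), (i : ℕ) + S.card = K ∧ (dualOperator K c i).eval lam ≠ 0 := by
  have hne : homogeneousCoeff (twist K lam c) (K - S.card) 0 ≠ 0 := fun hzero => h0 <| by
    refine (eval_indicialPolynomial_twist_eq_zero_iff hc hS hK hroot).1
      (eval_newtonPolynomial_of_lt fun j hj => ?_)
    rwa [Fin.ext (by rw [Fin.val_zero]; omega : (j : ℕ) = (0 : Fin (N + 1)))]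
  have hle : S.card ≤ K := by
    by_contra! hlt
    exact hne (homogeneousCoeff_eq_zero (Or.inl (by rw [Fin.val_zero]; omega)))
  refine ⟨⟨K - S.card, by omega⟩, by dsimp only; omega, fun hzero => hne ?_⟩
  rw [← taylor_coeff_zero] at hzero
  rw [show (K : ℤ) - S.card = ((K - S.card : ℕ) : ℤ) - (0 : Fin (N + 1)) by simp [hle],
    homogeneousCoeff_natCast_sub, ← hzero]
  exact coeff_dualOperator (recenter lam (dualOperator K c)) (0 : Fin (N + 1)) ⟨K - S.card, _⟩

lemma natCast_mem_exponents_dual_iff (hc : ∀ j, (c j).natDegree ≤ K)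
    (hS : ↑S ⊆ quasiPolynomialDegrees c lam) (hK : dualOperator K c (Fin.last K) ≠ 0)
    (hroot : (dualOperator K c (Fin.last K)).rootMultiplicity lam = S.card)
    {U : Submodule ℂ (ℂ → ℂ)} [FiniteDimensional ℂ U] (hU : U ≤ solutionSpace (dualOperator K c))
    (hdim : Module.finrank ℂ U = K) {d : ℕ} (hd : d + S.card = K) {t : ℕ} :
    (t : ℤ) ∈ exponents U lam ↔ t < d ∨ ∃ s ∈ S, t = s + d := by
  have hdK : -(d : ℤ) = S.card - K := by omega
  rw [← eval_indicialPolynomial_eq_zero_iff (h := -d) hU hdim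
    (fun g hg => homogeneousCoeff_recenter_dualOperator_eq_zero hc hS (hdK ▸ hg))
    (hdK ▸ homogeneousCoeff_recenter_dualOperator_ne_zero hK hroot)]
  rcases lt_or_ge t d with htd | htd
  · exact iff_of_true (eval_newtonPolynomial_of_lt fun i hi =>
      homogeneousCoeff_eq_zero (Or.inl (by omega))) (Or.inl htd)
  · obtain ⟨s, rfl⟩ := Nat.exists_eq_add_of_le' htd
    rw [← dualOperator_twist, eval_indicialPolynomial_dualOperator natDegree_twist_le,
      mul_eq_zero_iff_left (by simp [Nat.descFactorial_eq_zero_iff_lt]),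
      show (d : ℤ) = K - S.card by omega,
      eval_indicialPolynomial_twist_eq_zero_iff hc hS hK hroot]
    simp

end Infinity

lemma linearIndependent_of_injective_natDegree {ι : Type*} {p : ι → ℂ[X]} (hp : ∀ i, p i ≠ 0)
    (hdeg : Function.Injective fun i => (p i).natDegree) : LinearIndependent ℂ p := by
  refine linearIndependent_iff'.2 fun t a ha i hi => by_contra fun hai => ?_
  have hdegree := degree_sum_eq_of_disjoint (fun i => a i • p i) t fun j hj l hl hjl h => by
    have hj0 : a j ≠ 0 := left_ne_zero_of_smul hj.2
    have hl0 : a l ≠ 0 := left_ne_zero_of_smul hl.2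
    refine hjl (hdeg (natDegree_eq_natDegree ?_))
    simpa only [Function.comp_apply, degree_smul_of_smul_regular _ (IsSMulRegular.of_ne_zero hj0),
      degree_smul_of_smul_regular _ (IsSMulRegular.of_ne_zero hl0)] using h
  rw [ha, degree_zero] at hdegree
  have hle : (a i • p i).degree ≤ ⊥ := hdegree ▸ Finset.le_sup (f := fun i => (a i • p i).degree) hi
  exact smul_ne_zero hai (hp i) (degree_eq_bot.1 (le_bot_iff.1 hle))

/-- The map `p ↦ p exp (lam x)` from polynomials to entire functions. -/
def quasiPolynomialMap (lam : ℂ) : ℂ[X] →ₗ[ℂ] entireFunctions where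
  toFun p := ⟨quasiPolynomial p lam, differentiable_quasiPolynomial p lam⟩
  map_add' p q := Subtype.ext <| funext fun x => by simp [quasiPolynomial, add_mul]
  map_smul' a p := Subtype.ext <| funext fun x => by simp [quasiPolynomial, mul_assoc]

lemma injective_quasiPolynomialMap (lam : ℂ) : Function.Injective (quasiPolynomialMap lam) := by
  refine (injective_iff_map_eq_zero _).2 fun p hp => Polynomial.funext fun x => ?_
  rw [eval_zero]
  exact (mul_eq_zero.1 (congrFun (congrArg Subtype.val hp) x)).resolve_right
    (Complex.exp_ne_zero _)

lemma quasiPolynomialMap_mem_maxGenEigenspace (p : ℂ[X]) (lam : ℂ) :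
    quasiPolynomialMap lam p ∈ entireDeriv.maxGenEigenspace lam := by
  have hstep : ∀ q : ℂ[X], (entireDeriv - lam • 1) (quasiPolynomialMap lam q) =
      quasiPolynomialMap lam (derivative q) := fun q => by
    rw [LinearMap.sub_apply, sub_eq_iff_eq_add, LinearMap.smul_apply, Module.End.one_apply,
      ← map_smul, ← map_add]
    exact Subtype.ext (deriv_quasiPolynomial q lam)
  have hpow : ∀ m : ℕ, ((entireDeriv - lam • 1) ^ m) (quasiPolynomialMap lam p) =
      quasiPolynomialMap lam (derivative^[m] p) := fun m => by
    induction m with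
    | zero => simp
    | succ m ih =>
      rw [pow_succ', Module.End.mul_apply, ih, hstep, Function.iterate_succ_apply']
  refine Module.End.mem_maxGenEigenspace _ _ _ |>.2 ⟨p.natDegree + 1, ?_⟩
  rw [hpow, iterate_derivative_eq_zero (Nat.lt_succ_self _), map_zero]

lemma linearIndependent_quasiPolynomial {ι : Type*} {κ : ι → Type*} {p : ∀ i, κ i → ℂ[X]}
    (hp : ∀ i j, p i j ≠ 0) (hdeg : ∀ i, Function.Injective fun j => (p i j).natDegree)
    {lam : ι → ℂ} (hlam : Function.Injective lam) :
    LinearIndependent ℂ fun v : Σ i, κ i => quasiPolynomial (p v.1 v.2) (lam v.1) := by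
  have hspan : ∀ i, Submodule.span ℂ (Set.range fun j => quasiPolynomialMap (lam i) (p i j)) ≤
      entireDeriv.maxGenEigenspace (lam i) := fun i =>
    Submodule.span_le.2 <| Set.range_subset_iff.2 fun j =>
      quasiPolynomialMap_mem_maxGenEigenspace _ _
  have hindep := (Module.End.independent_maxGenEigenspace entireDeriv).comp hlam
  refine (linearIndependent_iUnion_finite (f := fun i j => quasiPolynomialMap (lam i) (p i j))
    (fun i => ?_) fun i t _ hi => ?_).map' entireFunctions.subtype (Submodule.ker_subtype _)
  · exact (linearIndependent_of_injective_natDegree (hp i) (hdeg i)).map'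
      (quasiPolynomialMap (lam i)) (LinearMap.ker_eq_bot.2 (injective_quasiPolynomialMap _))
  · refine (hindep i).mono (hspan i) (iSup₂_le fun j hj => (hspan j).trans ?_)
    exact le_iSup₂_of_le j (ne_of_mem_of_not_mem hj hi) le_rfl

section QuasiPolynomialSpace

variable {n : ℕ} {k : Fin n → ℕ}

lemma quasiPolynomialSpace_eq_span_range (p : ∀ i, Fin (k i) → ℂ[X]) (lam : Fin n → ℂ) :
    quasiPolynomialSpace p lam = Submodule.span ℂ
      (Set.range fun v : Σ i, Fin (k i) => quasiPolynomial (p v.1 v.2) (lam v.1)) :=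
  congrArg (Submodule.span ℂ) <| Set.ext fun _ =>
    ⟨fun ⟨i, j, h⟩ => ⟨⟨i, j⟩, h.symm⟩, fun ⟨⟨i, j⟩, h⟩ => ⟨i, j, h.symm⟩⟩

lemma quasiPolynomial_mem_quasiPolynomialSpace (p : ∀ i, Fin (k i) → ℂ[X]) (lam : Fin n → ℂ)
    (i : Fin n) (j : Fin (k i)) :
    quasiPolynomial (p i j) (lam i) ∈ quasiPolynomialSpace p lam :=
  Submodule.subset_span ⟨i, j, rfl⟩

instance (p : ∀ i, Fin (k i) → ℂ[X]) (lam : Fin n → ℂ) :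
    FiniteDimensional ℂ (quasiPolynomialSpace p lam) := by
  rw [quasiPolynomialSpace_eq_span_range]
  exact FiniteDimensional.span_of_finite ℂ (Set.finite_range _)

variable {p : ∀ i, Fin (k i) → ℂ[X]} {lam : Fin n → ℂ}

lemma finrank_quasiPolynomialSpace (hp : ∀ i j, p i j ≠ 0)
    (hdeg : ∀ i, Function.Injective fun j => (p i j).natDegree) (hlam : Function.Injective lam) :
    Module.finrank ℂ (quasiPolynomialSpace p lam) = ∑ i, k i := by
  rw [quasiPolynomialSpace_eq_span_range,
    finrank_span_eq_card (linearIndependent_quasiPolynomial hp hdeg hlam)]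
  simp

lemma quasiPolynomialSpace_le_solutionSpace_iff {N : ℕ} {c : Fin (N + 1) → ℂ[X]} :
    quasiPolynomialSpace p lam ≤ solutionSpace c ↔
      ∀ i j, quasiPolynomial (p i j) (lam i) ∈ solutionSpace c := by
  rw [quasiPolynomialSpace_eq_span_range, Submodule.span_le, Set.range_subset_iff, Sigma.forall]
  rfl

lemma exists_quasiPolynomialSpace_le_solutionSpace {N : ℕ} (hN : ∑ i, k i = N)
    (p : ∀ i, Fin (k i) → ℂ[X]) (lam : Fin n → ℂ) :
    ∃ c : Fin (N + 1) → ℂ[X], c ≠ 0 ∧ quasiPolynomialSpace p lam ≤ solutionSpace c := by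
  let Q : Matrix (Σ i, Fin (k i)) (Fin (N + 1)) ℂ[X] := Matrix.of fun v j =>
    (twistedDerivative (lam v.1) ^ (j : ℕ)) (p v.1 v.2)
  have hninj : ¬ Function.Injective Q.mulVecLin := fun hinj => by
    have hcard := card_le_of_injective ℂ[X] Q.mulVecLin hinj
    simp [hN] at hcard
  simp only [injective_iff_map_eq_zero, not_forall] at hninj
  obtain ⟨c, hc, hc0⟩ := hninj
  refine ⟨c, hc0, quasiPolynomialSpace_le_solutionSpace_iff.2 fun i j => ?_⟩
  rw [quasiPolynomial_mem_solutionSpace_iff]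
  exact (Finset.sum_congr rfl fun l _ => mul_comm _ _).trans (congrFun hc ⟨i, j⟩)

end QuasiPolynomialSpace

/-- `∑ c j ∂ ^ j` is the differential operator of order `N = dim W` with polynomial coefficients
annihilating `W` whose coefficients have no common zero and whose leading coefficient is monic. -/
structure IsPrimitiveOperator {N : ℕ} (W : Submodule ℂ (ℂ → ℂ)) (c : Fin (N + 1) → ℂ[X]) :
    Prop where
  le_solutionSpace : W ≤ solutionSpace c
  finrank_eq : Module.finrank ℂ W = N
  monic : (c (Fin.last N)).Monic
  exists_eval_ne_zero : ∀ z, ∃ j, (c j).eval z ≠ 0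

section Primitive

variable {N : ℕ} {W : Submodule ℂ (ℂ → ℂ)}

lemma mem_solutionSpace_of_mul {c : Fin (N + 1) → ℂ[X]} {q : ℂ[X]} (hq : q ≠ 0) {f : ℂ → ℂ}
    (hf : f ∈ solutionSpace fun j => q * c j) : f ∈ solutionSpace c := by
  have hcont : Continuous (applyOperator c f) := continuous_finsetSum _ fun j _ =>
    (c j).continuous.mul (differentiable_iteratedDeriv hf.1 j).continuous
  have hdense : Dense {x | q.IsRoot x}ᶜ :=
    (q.finite_setOfPred_isRoot hq).countable.dense_compl ℂ
  refine ⟨hf.1, congrFun (hcont.ext_on hdense continuous_const fun x hx => ?_)⟩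
  have hfx := hf.2 x
  simp only [applyOperator, eval_mul, mul_assoc, ← Finset.mul_sum] at hfx
  exact (mul_eq_zero.1 hfx).resolve_left hx

lemma exists_isPrimitiveOperator [FiniteDimensional ℂ W] (hdim : Module.finrank ℂ W = N)
    {c : Fin (N + 1) → ℂ[X]} (hc : c ≠ 0) (hW : W ≤ solutionSpace c) :
    ∃ c : Fin (N + 1) → ℂ[X], IsPrimitiveOperator W c := by
  let := UniqueFactorizationMonoid.toNormalizedGCDMonoid ℂ[X]
  obtain ⟨b, hb, hgcd⟩ := Finset.extract_gcd c Finset.univ_nonempty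
  set g := Finset.univ.gcd c
  have hcb : c = fun j => g * b j := funext fun j => hb j (Finset.mem_univ j)
  have hg : g ≠ 0 := fun hg => hc (by rw [hcb, hg]; simp only [zero_mul]; rfl)
  have hWb : W ≤ solutionSpace b := fun f hf => mem_solutionSpace_of_mul hg (hcb ▸ hW hf)
  have hlast : b (Fin.last N) ≠ 0 := last_ne_zero hWb hdim fun hb0 => hc (by
    rw [hcb, hb0]; simp only [Pi.zero_apply, mul_zero]; rfl)
  set a := (b (Fin.last N)).leadingCoeff
  have ha : a ≠ 0 := leadingCoeff_ne_zero.2 hlast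
  refine ⟨fun j => C a⁻¹ * b j, fun f hf => mem_solutionSpace_of_mul (C_ne_zero.2 ha) ?_, hdim,
    by rw [mul_comm]; exact monic_mul_leadingCoeff_inv hlast, fun z => ?_⟩
  · simpa only [← mul_assoc, ← C_mul, mul_inv_cancel₀ ha, C_1, one_mul] using hWb hf
  · by_contra! hz
    have hdvd : X - C z ∣ Finset.univ.gcd b := Finset.dvd_gcd fun j _ => dvd_iff_isRoot.2 <| by
      simpa [ha] using hz j
    rw [hgcd] at hdvd
    exact not_isUnit_X_sub_C z (isUnit_of_dvd_one hdvd)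

end Primitive

section LeadingCoefficientOfDual

variable {N : ℕ} {c : Fin (N + 1) → ℂ[X]} {ι : Type*} [Fintype ι] {lam : ι → ℂ}
  {S : ι → Finset ℕ}

lemma prod_dvd_dualOperator_last {K : ℕ} (hc : ∀ j, (c j).natDegree ≤ K)
    (hlam : Function.Injective lam) (hS : ∀ i, ↑(S i) ⊆ quasiPolynomialDegrees c (lam i)) :
    ∏ i, (X - C (lam i)) ^ (S i).card ∣ dualOperator K c (Fin.last K) :=
  Finset.prod_dvd_of_coprime (fun _ _ _ _ hil => (pairwise_coprime_X_sub_C hlam hil).pow)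
    fun i _ => X_sub_C_pow_dvd_dualOperator_last hc (hS i)

lemma natDegree_prod_X_sub_C_pow (lam : ι → ℂ) (m : ι → ℕ) :
    (∏ i, (X - C (lam i)) ^ m i).natDegree = ∑ i, m i := by
  rw [natDegree_prod_of_monic _ _ fun i _ => (monic_X_sub_C _).pow _]
  simp

lemma natDegree_le_natDegree_last (hlam : Function.Injective lam)
    (hS : ∀ i, ↑(S i) ⊆ quasiPolynomialDegrees c (lam i)) (hN : ∑ i, (S i).card = N)
    (j : Fin (N + 1)) : (c j).natDegree ≤ (c (Fin.last N)).natDegree := by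
  obtain ⟨l, -, hl⟩ :=
    Finset.univ.exists_max_image (fun j => (c j).natDegree) ⟨j, Finset.mem_univ j⟩
  refine (hl j (Finset.mem_univ j)).trans ?_
  by_contra! hlt
  set K := (c l).natDegree with hK
  set q := dualOperator K c (Fin.last K) with hq
  have hcoeff : ∀ j : Fin (N + 1), q.coeff j = (c j).coeff K := fun j => by
    rw [hq, coeff_dualOperator, Fin.val_last]
  have hq0 : q ≠ 0 := fun hq0 => by
    have hlead : (c l).leadingCoeff = 0 := by rw [leadingCoeff, ← hK, ← hcoeff, hq0, coeff_zero]
    rw [leadingCoeff_eq_zero.1 hlead, natDegree_zero] at hK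
    omega
  have hdeg : N ≤ q.natDegree := by
    rw [← hN, ← natDegree_prod_X_sub_C_pow lam]
    exact natDegree_le_of_dvd
      (prod_dvd_dualOperator_last (fun j => hl j (Finset.mem_univ j)) hlam hS) hq0
  have hNq : q.natDegree = N := le_antisymm (natDegree_dualOperator_le c _) hdeg
  refine hq0 (leadingCoeff_eq_zero.1 ?_)
  rw [leadingCoeff, hNq]
  exact (hcoeff (Fin.last N)).trans (coeff_eq_zero_of_natDegree_lt hlt)

lemma dualOperator_last_eq_prod (hc : (c (Fin.last N)).Monic) (hlam : Function.Injective lam)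
    (hS : ∀ i, ↑(S i) ⊆ quasiPolynomialDegrees c (lam i)) (hN : ∑ i, (S i).card = N) :
    dualOperator (c (Fin.last N)).natDegree c (Fin.last _) =
      ∏ i, (X - C (lam i)) ^ (S i).card := by
  have hmonic : (dualOperator (c (Fin.last N)).natDegree c (Fin.last _)).Monic := by
    refine monic_of_natDegree_le_of_coeff_eq_one N (natDegree_dualOperator_le c _) ?_
    exact (coeff_dualOperator c _ (Fin.last N)).trans hc.coeff_natDegree
  refine (eq_of_monic_of_dvd_of_natDegree_le
    (monic_prod_of_monic _ _ fun i _ => (monic_X_sub_C _).pow _) hmonic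
    (prod_dvd_dualOperator_last (natDegree_le_natDegree_last hlam hS hN) hlam hS) ?_)
  rw [natDegree_prod_X_sub_C_pow, hN]
  exact natDegree_dualOperator_le c _

lemma rootMultiplicity_prod_X_sub_C_pow (hlam : Function.Injective lam) (m : ι → ℕ) (i : ι) :
    (∏ l, (X - C (lam l)) ^ m l).rootMultiplicity (lam i) = m i := by
  classical
  have hrest : ¬ (∏ l ∈ Finset.univ.erase i, (X - C (lam l)) ^ m l).IsRoot (lam i) := by
    simp only [IsRoot, eval_prod, Finset.prod_eq_zero_iff, not_exists, not_and]
    refine fun l hl => ?_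
    simpa using fun h => absurd (hlam (sub_eq_zero.1 h)).symm (Finset.ne_of_mem_erase hl)
  rw [← Finset.mul_prod_erase _ _ (Finset.mem_univ i), rootMultiplicity_mul,
    rootMultiplicity_X_sub_C_pow, rootMultiplicity_eq_zero hrest, add_zero]
  exact mul_ne_zero (pow_ne_zero _ (X_sub_C_ne_zero _)) fun h0 =>
    hrest (by rw [h0]; exact eval_zero)

end LeadingCoefficientOfDual

/-- The matrix of the Wronskian: its `i`-th row is the jet of `f i` at `x`. -/
def wronskianMatrix {N : ℕ} (f : Fin N → ℂ → ℂ) (x : ℂ) : Matrix (Fin N) (Fin N) ℂ :=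
  Matrix.of fun i l => iteratedDeriv (l : ℕ) (f i) x

lemma eventually_nhdsNE_of_codiscrete {P : ℂ → Prop} (h : ∀ᶠ x in codiscrete ℂ, P x) (z : ℂ) :
    ∀ᶠ x in 𝓝[≠] z, P x := by
  have hz := mem_codiscrete.1 h z
  rwa [disjoint_principal_right, compl_compl] at hz

lemma eventually_codiscrete_eval_ne_zero {q : ℂ[X]} (hq : q ≠ 0) :
    ∀ᶠ x in codiscrete ℂ, q.eval x ≠ 0 :=
  compl_finite_mem_codiscreteWithin (q.finite_setOfPred_isRoot hq)

lemma meromorphicAt_eval (q : ℂ[X]) (z : ℂ) : MeromorphicAt (fun x => q.eval x) z :=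
  (q.differentiable.analyticAt z).meromorphicAt

lemma meromorphicOrderAt_eval {q : ℂ[X]} (hq : q ≠ 0) (z : ℂ) :
    meromorphicOrderAt (fun x => q.eval x) z = ((q.rootMultiplicity z : ℤ) : WithTop ℤ) := by
  obtain ⟨r, hr, hrz⟩ := exists_eq_pow_rootMultiplicity_mul_and_not_dvd q hq z
  refine (meromorphicOrderAt_eq_int_iff (meromorphicAt_eval q z)).2
    ⟨fun x => r.eval x, r.differentiable.analyticAt z, fun h => hrz (dvd_iff_isRoot.2 h),
      Eventually.of_forall fun x => ?_⟩
  conv_lhs => rw [hr]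
  simp

namespace IsPrimitiveOperator

variable {N : ℕ} {W : Submodule ℂ (ℂ → ℂ)} {c : Fin (N + 1) → ℂ[X]}

lemma le_entireFunctions (h : IsPrimitiveOperator W c) : W ≤ entireFunctions :=
  h.le_solutionSpace.trans (solutionSpace_le_entireFunctions c)

lemma exists_isMonicFundamentalOperator (h : IsPrimitiveOperator W c) :
    ∃ A, IsMonicFundamentalOperator N W A := by
  refine ⟨fun j => Function.update (fun j x => (c j).eval x / (c (Fin.last N)).eval x)
    (Fin.last N) 1 j, h.finrank_eq, fun j z => ?_, fun x => by simp, fun f hf => ?_⟩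
  · rcases eq_or_ne j (Fin.last N) with rfl | hj
    · rw [Function.update_self]
      exact MeromorphicAt.const 1 z
    · rw [Function.update_of_ne hj]
      exact (meromorphicAt_eval _ z).div (meromorphicAt_eval _ z)
  · filter_upwards [eventually_codiscrete_eval_ne_zero h.monic.ne_zero] with x hx
    have hdiv : ∀ j, Function.update (fun j x => (c j).eval x / (c (Fin.last N)).eval x)
        (Fin.last N) 1 j x = (c j).eval x / (c (Fin.last N)).eval x := fun j => by
      rcases eq_or_ne j (Fin.last N) with rfl | hj
      · simp [hx]
      · simp [hj]
    have hfx := (h.le_solutionSpace hf).2 x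
    rw [applyOperator] at hfx
    simp only [hdiv, div_mul_eq_mul_div, ← Finset.sum_div, hfx, zero_div, Pi.zero_apply]

variable [FiniteDimensional ℂ W]

lemma mem_singularPoints_iff (h : IsPrimitiveOperator W c) {z : ℂ} :
    z ∈ singularPoints W ↔ (c (Fin.last N)).IsRoot z := by
  refine ⟨fun hz => by_contra fun hroot => hz ?_, fun hroot hz => ?_⟩
  · rw [h.finrank_eq]
    exact exponents_eq_of_eval_last_ne_zero h.le_solutionSpace h.finrank_eq hroot
  · have hexp : exponents W z = shiftedExponents N 0 Fin.elim0 := by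
      simpa [shiftedExponents, h.finrank_eq] using hz
    have hmult := rootMultiplicity_last_eq h.le_solutionSpace h.finrank_eq
      (h.exists_eval_ne_zero z) N.zero_le (fun b => b.elim0) hexp
    exact (rootMultiplicity_pos h.monic.ne_zero).2 hroot |>.ne' hmult

lemma singularPoints_eq (h : IsPrimitiveOperator W c) :
    singularPoints W = (c (Fin.last N)).roots.toFinset := by
  ext z
  simp [h.mem_singularPoints_iff, h.monic.ne_zero]

lemma wronskian_ne_zero (h : IsPrimitiveOperator W c) (b : Module.Basis (Fin N) ℂ W)
    {x : ℂ} (hx : (c (Fin.last N)).eval x ≠ 0) :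
    Wronskian (fun i => (b i : ℂ → ℂ)) x ≠ 0 := by
  intro hdet
  obtain ⟨v, hv, hvF⟩ := Matrix.exists_vecMul_eq_zero_iff.2 hdet
  set f : W := ∑ i, v i • b i with hf
  have hf0 : (f : ℂ → ℂ) ≠ 0 := fun h0 => hv <| funext <|
    Fintype.linearIndependent_iff.1 b.linearIndependent v (Subtype.ext h0)
  have hjet : ∀ l < N, iteratedDeriv l (f : ℂ → ℂ) x = 0 := fun l hl => by
    rw [hf, Submodule.coe_sum]
    exact (iteratedDeriv_sum_smul (fun i _ => h.le_entireFunctions (b i).2) l x).trans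
      (congrFun hvF ⟨l, hl⟩)
  have hfe := h.le_entireFunctions f.2
  obtain ⟨s, hs⟩ := exists_meromorphicOrderAt_eq_natCast hfe hf0 x
  have hmem : (s : ℤ) ∈ exponents W x := ⟨f, f.2, hs⟩
  rw [exponents_eq_of_eval_last_ne_zero h.le_solutionSpace h.finrank_eq hx] at hmem
  exact ((meromorphicOrderAt_eq_natCast_iff hfe).1 hs).2 (hjet s (by exact_mod_cast hmem.2))

lemma eventually_eq_div (h : IsPrimitiveOperator W c) {A : Fin (N + 1) → ℂ → ℂ}
    (hA : IsMonicFundamentalOperator N W A) :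
    ∀ᶠ x in codiscrete ℂ, ∀ j, A j x = (c j).eval x / (c (Fin.last N)).eval x := by
  let b : Module.Basis (Fin N) ℂ W := Module.finBasisOfFinrankEq ℂ W h.finrank_eq
  have hann : ∀ᶠ x in codiscrete ℂ, ∀ i,
      ∑ j : Fin (N + 1), A j x * iteratedDeriv (j : ℕ) (b i : ℂ → ℂ) x = 0 :=
    eventually_all.2 fun i => hA.annihilates _ (b i).2
  filter_upwards [hann, eventually_codiscrete_eval_ne_zero h.monic.ne_zero] with x hx hlast
  let w := (c (Fin.last N)).eval x
  -- The difference of the two monic operators has order less than `N` and still kills the basis.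
  have hzero : (wronskianMatrix (fun i => (b i : ℂ → ℂ)) x).mulVec
      (fun j => w * A j.castSucc x - (c j.castSucc).eval x) = 0 := funext fun i => by
    have hAi := hx i
    have hci := (h.le_solutionSpace (b i).2).2 x
    rw [applyOperator] at hci
    rw [Fin.sum_univ_castSucc, hA.monic, one_mul] at hAi
    rw [Fin.sum_univ_castSucc] at hci
    simp only [Matrix.mulVec, dotProduct, wronskianMatrix, Matrix.of_apply, mul_sub,
      Finset.sum_sub_distrib, Pi.zero_apply]
    simp only [mul_left_comm _ w, ← Finset.mul_sum, mul_comm (iteratedDeriv _ _ x)]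
    simp only [Fin.val_castSucc] at hAi hci
    linear_combination w * hAi - hci
  have hvec := Matrix.eq_zero_of_mulVec_eq_zero (h.wronskian_ne_zero b hlast) hzero
  refine Fin.lastCases ?_ fun j => ?_
  · rw [hA.monic, div_self hlast]
  · rw [eq_div_iff hlast, mul_comm]
    exact sub_eq_zero.1 (congrFun hvec j)

lemma meromorphicOrderAt_pow_mul (h : IsPrimitiveOperator W c) {A : Fin (N + 1) → ℂ → ℂ}
    (hA : IsMonicFundamentalOperator N W A) (z : ℂ) (k : ℕ) (j : Fin (N + 1)) :
    meromorphicOrderAt (fun x => (x - z) ^ k * A j x) z =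
      ((k - (c (Fin.last N)).rootMultiplicity z : ℤ) : WithTop ℤ) +
        meromorphicOrderAt (fun x => (c j).eval x) z := by
  have hcongr : (fun x => (x - z) ^ k * A j x) =ᶠ[𝓝[≠] z]
      (· - z) ^ k * ((fun x => (c (Fin.last N)).eval x)⁻¹ * fun x => (c j).eval x) := by
    filter_upwards [eventually_nhdsNE_of_codiscrete (h.eventually_eq_div hA) z] with x hx
    rw [hx j, div_eq_inv_mul]
    rfl
  have hpow : MeromorphicAt ((· - z) ^ k) z := by fun_prop
  have hinv := (meromorphicAt_eval (c (Fin.last N)) z).inv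
  rw [meromorphicOrderAt_congr hcongr,
    meromorphicOrderAt_mul hpow (hinv.mul (meromorphicAt_eval _ z)),
    meromorphicOrderAt_mul hinv (meromorphicAt_eval _ z), meromorphicOrderAt_inv,
    meromorphicOrderAt_eval h.monic.ne_zero, meromorphicOrderAt_pow_id_sub_const, ← add_assoc]
  rfl

lemma poleOrder_eq (h : IsPrimitiveOperator W c) (z : ℂ) :
    poleOrder W z = (c (Fin.last N)).rootMultiplicity z := by
  obtain rfl := h.finrank_eq
  set μ := (c (Fin.last _)).rootMultiplicity z
  obtain ⟨A, hA⟩ := h.exists_isMonicFundamentalOperator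
  have hmem : ∀ j, 0 ≤ meromorphicOrderAt (fun x => (x - z) ^ μ * A j x) z := fun j => by
    rw [h.meromorphicOrderAt_pow_mul hA, sub_self, WithTop.coe_zero, zero_add]
    exact ((c j).differentiable.analyticAt z).meromorphicOrderAt_nonneg
  refine le_antisymm (Nat.sInf_le ⟨A, hA, hmem⟩) (le_csInf ⟨μ, A, hA, hmem⟩ ?_)
  rintro k ⟨B, hB, hk⟩
  obtain ⟨j, hj⟩ := h.exists_eval_ne_zero z
  have hkj := hk j
  rw [h.meromorphicOrderAt_pow_mul hB, meromorphicOrderAt_eval (by rintro h0; simp [h0] at hj),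
    rootMultiplicity_eq_zero hj, Nat.cast_zero, WithTop.coe_zero, add_zero] at hkj
  have : (0 : ℤ) ≤ k - μ := by exact_mod_cast hkj
  omega

lemma regularizingFactor_eq (h : IsPrimitiveOperator W c) (x : ℂ) :
    regularizingFactor W x = (c (Fin.last N)).eval x := by
  have hsplit := prod_multiset_X_sub_C_of_monic_of_roots_card_eq h.monic
    IsAlgClosed.card_roots_eq_natDegree
  rw [regularizingFactor, h.singularPoints_eq, finprod_mem_coe_finset]
  conv_rhs => rw [← hsplit, Finset.prod_multiset_map_count, eval_prod]
  exact Finset.prod_congr rfl fun z _ => by simp [h.poleOrder_eq]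

lemma isRegularizedFundamentalOperator (h : IsPrimitiveOperator W c) :
    IsRegularizedFundamentalOperator N W fun j x => (c j).eval x := by
  obtain ⟨A, hA⟩ := h.exists_isMonicFundamentalOperator
  refine ⟨h.singularPoints_eq ▸ Finset.finite_toSet _, A, hA, fun j => ⟨(c j).differentiable, ?_⟩⟩
  filter_upwards [h.eventually_eq_div hA,
    eventually_codiscrete_eval_ne_zero h.monic.ne_zero] with x hx hlast
  rw [h.regularizingFactor_eq, hx j, mul_div_cancel₀ _ hlast]

lemma eq_of_isRegularizedFundamentalOperator (h : IsPrimitiveOperator W c)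
    {d : Fin (N + 1) → ℂ[X]}
    (hd : IsRegularizedFundamentalOperator N W fun j x => (d j).eval x) : d = c := by
  obtain ⟨-, A, hA, hdA⟩ := hd
  funext j
  have heq : ∀ᶠ x in codiscrete ℂ, (d j - c j).eval x = 0 := by
    filter_upwards [h.eventually_eq_div hA, (hdA j).2,
      eventually_codiscrete_eval_ne_zero h.monic.ne_zero] with x hx hdx hlast
    rw [eval_sub, hdx, h.regularizingFactor_eq, hx j, mul_div_cancel₀ _ hlast, sub_self]
  by_contra hne
  have hfalse := heq.and (eventually_codiscrete_eval_ne_zero (sub_ne_zero.2 hne))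
  obtain ⟨x, hx, hx'⟩ := (eventually_nhdsNE_of_codiscrete hfalse 0).exists
  exact hx' hx

end IsPrimitiveOperator

lemma inv_last_apply {N : ℕ} (A : Matrix (Fin (N + 1)) (Fin (N + 1)) ℂ) (i : Fin (N + 1)) :
    A⁻¹ (Fin.last N) i =
      (-1) ^ ((i : ℕ) + N) * (A.submatrix i.succAbove Fin.castSucc).det / A.det := by
  rw [Matrix.inv_def, Matrix.smul_apply, Matrix.adjugate_fin_succ_eq_det_submatrix,
    Ring.inverse_eq_inv', smul_eq_mul, Fin.val_last, Fin.succAbove_last, div_eq_inv_mul]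

/-- The `i`-th element of the basis of the conjugate space attached to the basis `f`, that is,
`± Wr(f_0, …, f_(i-1), f_(i+1), …, f_N) / Wr(f_0, …, f_N)`, encoded as an entry of the inverse of
the matrix of the Wronskian. -/
def conjugateFunction {N : ℕ} (f : Fin (N + 1) → ℂ → ℂ) (i : Fin (N + 1)) (x : ℂ) : ℂ :=
  (wronskianMatrix f x)⁻¹ (Fin.last N) i

lemma conjugateFunction_eq_smul_wronskian_div {N : ℕ} (f : Fin (N + 1) → ℂ → ℂ)
    (i : Fin (N + 1)) :
    conjugateFunction f i = (-1 : ℂ) ^ ((i : ℕ) + N) •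
      fun x => Wronskian (fun k => f (i.succAbove k)) x / Wronskian f x :=
  funext fun _ => (inv_last_apply _ i).trans (mul_div_assoc _ _ _)

lemma wronskian_eq_of_jet_last_eq {N : ℕ} {f : Fin (N + 1) → ℂ → ℂ} {x : ℂ}
    (hjet : ∀ l : Fin (N + 1), iteratedDeriv l (f (Fin.last N)) x =
      (Pi.single (Fin.last N) 1 : Fin (N + 1) → ℂ) l) :
    Wronskian f x = Wronskian (fun i : Fin N => f i.castSucc) x := by
  rw [Wronskian, Matrix.det_succ_row _ (Fin.last N), Finset.sum_eq_single (Fin.last N)]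
  · rw [Matrix.of_apply, hjet, Pi.single_eq_same, Even.neg_one_pow ⟨_, rfl⟩, one_mul, one_mul,
      Fin.succAbove_last]
    rfl
  · intro l _ hl
    rw [Matrix.of_apply, hjet, Pi.single_eq_of_ne hl, mul_zero, zero_mul]
  · simp

section ConjugateSpace

variable {N : ℕ} {W : Submodule ℂ (ℂ → ℂ)}

lemma iteratedDeriv_coe_sum_smul (hW : W ≤ entireFunctions) (b : Fin N → W) (v : Fin N → ℂ)
    (l : ℕ) (x : ℂ) :
    iteratedDeriv l ((∑ i, v i • b i : W) : ℂ → ℂ) x =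
      ∑ i, v i * iteratedDeriv l (b i : ℂ → ℂ) x := by
  rw [Submodule.coe_sum]
  exact iteratedDeriv_sum_smul (fun i _ => hW (b i).2) l x

lemma wronskian_eq_det_mul (hW : W ≤ entireFunctions) (b : Module.Basis (Fin N) ℂ W)
    (w : Fin N → W) (x : ℂ) :
    Wronskian (fun i => (w i : ℂ → ℂ)) x =
      b.det w * Wronskian (fun i => (b i : ℂ → ℂ)) x := by
  have hmul : wronskianMatrix (fun i => (w i : ℂ → ℂ)) x =
      (b.toMatrix w).transpose * wronskianMatrix (fun i => (b i : ℂ → ℂ)) x := by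
    ext i l
    simp only [wronskianMatrix, Matrix.mul_apply, Matrix.transpose_apply, Matrix.of_apply,
      Module.Basis.toMatrix_apply]
    conv_lhs => rw [← b.sum_repr (w i)]
    exact iteratedDeriv_coe_sum_smul hW _ _ _ _
  rw [b.det_apply, ← Matrix.det_transpose (b.toMatrix w)]
  exact (congrArg Matrix.det hmul).trans (Matrix.det_mul _ _)

lemma sum_conjugateFunction_mul {f : Fin (N + 1) → ℂ → ℂ} {x : ℂ} (hx : Wronskian f x ≠ 0)
    (l : Fin (N + 1)) :
    ∑ i, conjugateFunction f i x * iteratedDeriv l (f i) x =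
      (Pi.single (Fin.last N) 1 : Fin (N + 1) → ℂ) l := by
  have hinv := congrFun (congrFun (Matrix.nonsing_inv_mul (wronskianMatrix f x)
    (isUnit_iff_ne_zero.2 hx)) (Fin.last N)) l
  rwa [Matrix.mul_apply, Matrix.one_eq_pi_single] at hinv

lemma wronskian_div_eq_sum (hW : W ≤ entireFunctions) (b b' : Module.Basis (Fin (N + 1)) ℂ W)
    (f : Fin N → W) (x : ℂ) :
    Wronskian (fun i => (f i : ℂ → ℂ)) x / Wronskian (fun i => (b' i : ℂ → ℂ)) x =
      ∑ i, b'.det (Fin.snoc f (b i) : Fin (N + 1) → W) *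
        conjugateFunction (fun i => (b i : ℂ → ℂ)) i x := by
  have hdet := wronskian_eq_det_mul hW b b' x
  by_cases hx : Wronskian (fun i => (b i : ℂ → ℂ)) x = 0
  · simp [hdet, hx, conjugateFunction_eq_smul_wronskian_div]
  -- Append to `f` the element of `W` with jet `(0, …, 0, 1)` at `x`: this leaves `Wr` unchanged.
  set v : W := ∑ i, conjugateFunction (fun i => (b i : ℂ → ℂ)) i x • b i with hv
  have hjet : ∀ l : Fin (N + 1),
      iteratedDeriv l (v : ℂ → ℂ) x = (Pi.single (Fin.last N) 1 : Fin (N + 1) → ℂ) l := fun l => by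
    rw [hv, iteratedDeriv_coe_sum_smul hW, sum_conjugateFunction_mul hx]
  have hsnoc := wronskian_eq_of_jet_last_eq (x := x)
    (f := fun i => ((Fin.snoc f v : Fin (N + 1) → W) i : ℂ → ℂ)) (by simpa using hjet)
  simp only [Fin.snoc_castSucc] at hsnoc
  rw [← hsnoc, wronskian_eq_det_mul hW b', mul_div_cancel_right₀]
  · let L : W →ₗ[ℂ] ℂ :=
      b'.det.toMultilinearMap.toLinearMap (Fin.snoc f 0 : Fin (N + 1) → W) (Fin.last N)
    have hL : ∀ w, b'.det (Fin.snoc f w : Fin (N + 1) → W) = L w := fun w => by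
      rw [MultilinearMap.toLinearMap_apply, Fin.update_snoc_last]
      rfl
    simp only [hL, hv, map_sum, map_smul, smul_eq_mul, mul_comm]
  · rw [hdet]
    exact mul_ne_zero (b.isUnit_det b').ne_zero hx

lemma conjugateSpace_eq_span (hW : W ≤ entireFunctions) (b : Module.Basis (Fin (N + 1)) ℂ W) :
    conjugateSpace W =
      Submodule.span ℂ (Set.range (conjugateFunction fun i => (b i : ℂ → ℂ))) := by
  have hcast : ∀ d, Module.finrank ℂ W = d → conjugateSpace W = Submodule.span ℂ
      {g | ∃ (b : Module.Basis (Fin d) ℂ W) (f : Fin (d - 1) → W), g = fun x =>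
        Wronskian (fun i => (f i : ℂ → ℂ)) x / Wronskian (fun i => (b i : ℂ → ℂ)) x} := by
    rintro d rfl
    rfl
  rw [hcast (N + 1) (by simp [Module.finrank_eq_card_basis b])]
  refine le_antisymm (Submodule.span_le.2 ?_) (Submodule.span_le.2 ?_)
  · rintro g ⟨b', f, rfl⟩
    refine (Submodule.mem_span_range_iff_exists_fun ℂ).2
      ⟨fun i => b'.det (Fin.snoc (α := fun _ => W) (n := N) f (b i)), funext fun x => ?_⟩
    rw [Finset.sum_apply]
    exact (wronskian_div_eq_sum hW b b' f x).symm
  · rintro g ⟨i, rfl⟩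
    rw [SetLike.mem_coe, conjugateFunction_eq_smul_wronskian_div]
    exact Submodule.smul_mem _ _ (Submodule.subset_span ⟨b, fun k => b (i.succAbove k), rfl⟩)

lemma regularizedConjugateSpace_eq_map (W : Submodule ℂ (ℂ → ℂ)) :
    regularizedConjugateSpace W =
      (conjugateSpace W).map (LinearMap.mulRight ℂ (regularizingFactor W)⁻¹) := by
  rw [← Submodule.span_eq ((conjugateSpace W).map _)]
  exact congrArg _ (Set.ext fun g => exists_congr fun f => and_congr_right fun _ => eq_comm)

/-- The basis of the regularized conjugate space of `W` attached to the basis `b` of `W`. -/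
def regularizedConjugateFunction (b : Module.Basis (Fin (N + 1)) ℂ W) (i : Fin (N + 1)) (x : ℂ) :
    ℂ :=
  conjugateFunction (fun i => (b i : ℂ → ℂ)) i x * (regularizingFactor W x)⁻¹

lemma regularizedConjugateSpace_eq_span (hW : W ≤ entireFunctions)
    (b : Module.Basis (Fin (N + 1)) ℂ W) :
    regularizedConjugateSpace W =
      Submodule.span ℂ (Set.range (regularizedConjugateFunction b)) := by
  rw [regularizedConjugateSpace_eq_map, conjugateSpace_eq_span hW b, Submodule.map_span,
    ← Set.range_comp]
  rfl

end ConjugateSpace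

section MatrixInverse

variable {ι : Type*} [Fintype ι] [DecidableEq ι] {A : ℂ → Matrix ι ι ℂ}

lemma differentiable_det (hA : ∀ i j, Differentiable ℂ fun x => A x i j) :
    Differentiable ℂ fun x => (A x).det := by
  simp only [Matrix.det_apply]
  exact .fun_sum fun σ _ => (Differentiable.fun_finsetProd fun i _ => hA _ _).const_smul _

lemma differentiableAt_inv_apply (hA : ∀ i j, Differentiable ℂ fun x => A x i j) {x : ℂ}
    (hx : (A x).det ≠ 0) (i j : ι) : DifferentiableAt ℂ (fun y => (A y)⁻¹ i j) x := by
  simp only [Matrix.inv_def, Matrix.smul_apply, Ring.inverse_eq_inv', smul_eq_mul,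
    Matrix.adjugate_apply]
  refine ((differentiable_det hA x).inv hx).mul (differentiable_det (fun k l => ?_) x)
  rcases eq_or_ne k j with rfl | hkj
  · simp only [Matrix.updateRow_self, differentiable_const]
  · simpa only [Matrix.updateRow_ne hkj] using hA k l

end MatrixInverse

section VariationOfParameters

variable {N : ℕ} {f : Fin N → ℂ → ℂ} {h : ℂ → ℂ} {x : ℂ}

lemma differentiable_wronskianMatrix_apply (hf : ∀ i, Differentiable ℂ (f i)) (i l : Fin N) :
    Differentiable ℂ fun x => wronskianMatrix f x i l :=
  differentiable_iteratedDeriv (hf i) l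

/-- The functions `H k` of the method of variation of parameters: those for which
`∑ k, H k * f k` agrees with `h` at every point together with its formal derivatives of order
less than `N`, the `H k` being treated as constants. -/
def variationCoeff (f : Fin N → ℂ → ℂ) (h : ℂ → ℂ) (k : Fin N) (x : ℂ) : ℂ :=
  Matrix.vecMul (fun l : Fin N => iteratedDeriv l h x) (wronskianMatrix f x)⁻¹ k

lemma sum_variationCoeff_mul (hx : Wronskian f x ≠ 0) (l : Fin N) :
    ∑ k, variationCoeff f h k x * iteratedDeriv l (f k) x = iteratedDeriv l h x := by
  have hvec : Matrix.vecMul (fun k => variationCoeff f h k x) (wronskianMatrix f x) =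
      fun l : Fin N => iteratedDeriv l h x := by
    refine (Matrix.vecMul_vecMul _ _ _).trans ?_
    rw [Matrix.nonsing_inv_mul (wronskianMatrix f x) (isUnit_iff_ne_zero.2 hx), Matrix.vecMul_one]
  exact congrFun hvec l

lemma differentiableAt_variationCoeff (hf : ∀ i, Differentiable ℂ (f i)) (hh : Differentiable ℂ h)
    (hx : Wronskian f x ≠ 0) (k : Fin N) : DifferentiableAt ℂ (variationCoeff f h k) x := by
  change DifferentiableAt ℂ (fun x => ∑ l : Fin N,
    iteratedDeriv l h x * (wronskianMatrix f x)⁻¹ l k) x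
  exact .fun_sum fun l _ => (differentiable_iteratedDeriv hh l x).fun_mul
    (differentiableAt_inv_apply (differentiable_wronskianMatrix_apply hf) hx l k)

lemma sum_deriv_variationCoeff_mul (hf : ∀ i, Differentiable ℂ (f i)) (hh : Differentiable ℂ h)
    (hx : Wronskian f x ≠ 0) (l : Fin N) :
    ∑ k, deriv (variationCoeff f h k) x * iteratedDeriv l (f k) x =
      iteratedDeriv (l + 1) h x -
        ∑ k, variationCoeff f h k x * iteratedDeriv (l + 1) (f k) x := by
  have hderiv : HasDerivAt (fun y => ∑ k, variationCoeff f h k y * iteratedDeriv l (f k) y)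
      (∑ k, (deriv (variationCoeff f h k) x * iteratedDeriv l (f k) x +
        variationCoeff f h k x * iteratedDeriv (l + 1) (f k) x)) x := by
    refine .fun_sum fun k _ => (differentiableAt_variationCoeff hf hh hx k).hasDerivAt.mul ?_
    rw [iteratedDeriv_succ]
    exact (differentiable_iteratedDeriv (hf k) l x).hasDerivAt
  have hcongr : (fun y => ∑ k, variationCoeff f h k y * iteratedDeriv l (f k) y) =ᶠ[𝓝 x]
      iteratedDeriv l h := by
    filter_upwards [(differentiable_det (differentiable_wronskianMatrix_apply
      hf)).continuous.continuousAt.eventually_ne hx] with y hy using sum_variationCoeff_mul hy l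
  rw [eq_sub_iff_add_eq, ← Finset.sum_add_distrib, ← hderiv.deriv, hcongr.deriv_eq,
    iteratedDeriv_succ]

end VariationOfParameters

lemma hasDerivAt_variationCoeff {N : ℕ} {c : Fin (N + 1 + 1) → ℂ[X]} {f : Fin (N + 1) → ℂ → ℂ}
    (hf : ∀ i, f i ∈ solutionSpace c) {h : ℂ → ℂ} (hh : Differentiable ℂ h) {x : ℂ}
    (hx : Wronskian f x ≠ 0) (hc : (c (Fin.last (N + 1))).eval x ≠ 0) (i : Fin (N + 1)) :
    HasDerivAt (variationCoeff f h i)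
      (applyOperator c h x / (c (Fin.last (N + 1))).eval x * conjugateFunction f i x) x := by
  set w := (c (Fin.last (N + 1))).eval x
  set H' : Fin (N + 1) → ℂ := fun k => deriv (variationCoeff f h k) x
  have hent : ∀ i, Differentiable ℂ (f i) := fun i => (hf i).1
  have hvec : Matrix.vecMul H' (wronskianMatrix f x) =
      Pi.single (Fin.last N) (applyOperator c h x / w) := by
    refine funext fun l => (sum_deriv_variationCoeff_mul hent hh hx l).trans ?_
    induction l using Fin.lastCases with
    | cast l =>
      rw [Pi.single_eq_of_ne l.castSucc_ne_last, sub_eq_zero]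
      exact (sum_variationCoeff_mul hx l.succ).symm
    | last =>
      have hzero : ∑ k, variationCoeff f h k x * applyOperator c (f k) x = 0 :=
        Finset.sum_eq_zero fun k _ => by rw [(hf k).2 x, mul_zero]
      simp only [applyOperator, Finset.mul_sum, mul_left_comm _ (eval x _)] at hzero
      rw [Finset.sum_comm, Fin.sum_univ_castSucc] at hzero
      simp only [← Finset.mul_sum] at hzero
      have hlow : ∀ j : Fin (N + 1), ∑ k, variationCoeff f h k x *
          iteratedDeriv j.castSucc (f k) x = iteratedDeriv j h x := sum_variationCoeff_mul hx
      have happly : applyOperator c h x = ∑ j : Fin (N + 1), (c j.castSucc).eval x *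
          iteratedDeriv j h x + w * iteratedDeriv (N + 1) h x := Fin.sum_univ_castSucc _
      rw [Pi.single_eq_same, eq_div_iff hc, happly]
      simp only [hlow, Fin.val_last] at hzero ⊢
      linear_combination -hzero
  have hinv : H' = Matrix.vecMul (Pi.single (Fin.last N) (applyOperator c h x / w))
      (wronskianMatrix f x)⁻¹ := by
    rw [← hvec, Matrix.vecMul_vecMul,
      Matrix.mul_nonsing_inv (wronskianMatrix f x) (isUnit_iff_ne_zero.2 hx), Matrix.vecMul_one]
  have hderiv := (differentiableAt_variationCoeff hent hh hx i).hasDerivAt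
  rwa [show deriv (variationCoeff f h i) x = _ from congrFun hinv i, Matrix.single_vecMul] at hderiv

section LocalForm

lemma det_descFactorial_ne_zero {n : ℕ} {e : Fin n → ℕ} (he : Function.Injective e) :
    (Matrix.of fun i j : Fin n => ((e i).descFactorial j : ℂ)).det ≠ 0 := by
  have hdet := Matrix.det_eval_matrixOfPolynomials_eq_det_vandermonde (fun i => (e i : ℂ))
    (fun j => descPochhammer ℂ j) (fun j => descPochhammer_natDegree ℂ j)
    fun j => monic_descPochhammer ℂ j
  simp only [descPochhammer_eval_eq_descFactorial] at hdet
  rw [← hdet]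
  exact Matrix.det_vandermonde_ne_zero_iff.2 (Nat.cast_injective.comp he)

lemma inv_diagonal {ι : Type*} [Fintype ι] [DecidableEq ι] {v : ι → ℂ} (hv : ∀ i, v i ≠ 0) :
    (Matrix.diagonal v)⁻¹ = Matrix.diagonal v⁻¹ := by
  refine Matrix.inv_eq_right_inv ?_
  rw [Matrix.diagonal_mul_diagonal, ← Matrix.diagonal_one]
  exact congrArg _ (funext fun i => mul_inv_cancel₀ (hv i))

variable {N : ℕ} {f : Fin (N + 1) → ℂ → ℂ} {z : ℂ} {e : Fin (N + 1) → ℕ}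

lemma exists_wronskianMatrix_eq (hf : ∀ i, Differentiable ℂ (f i))
    (hord : ∀ i, meromorphicOrderAt (f i) z = ((e i : ℤ) : WithTop ℤ)) :
    ∃ (A : ℂ → Matrix (Fin (N + 1)) (Fin (N + 1)) ℂ) (u : Fin (N + 1) → ℂ), (∀ i, u i ≠ 0) ∧
      (∀ i l, Differentiable ℂ fun x => A x i l) ∧
      (∀ i l, A z i l = u i * (e i).descFactorial l) ∧
      ∀ x ≠ z, wronskianMatrix f x = Matrix.diagonal (fun i => (x - z) ^ e i) * A x *
        Matrix.diagonal fun l : Fin (N + 1) => ((x - z) ^ (l : ℕ))⁻¹ := by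
  choose u hu huz hfu using fun i => exists_eq_pow_mul (hf i) (hord i)
  choose v hv hvz hfv using fun i j => exists_iteratedDeriv_eq_zpow_mul (hu i) (hfu i) j
  refine ⟨fun x => Matrix.of fun i l => v i l x, fun i => u i z, huz, fun i l => hv i l,
    fun i l => (hvz i l).trans (mul_comm _ _), fun x hx => ?_⟩
  ext i l
  have hentry : wronskianMatrix f x i l = (x - z) ^ ((e i : ℤ) - (l : ℕ)) * v i l x := hfv i l x hx
  rw [hentry, Matrix.mul_diagonal, Matrix.diagonal_mul, zpow_sub₀ (sub_ne_zero.2 hx),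
    zpow_natCast, zpow_natCast, div_eq_mul_inv, mul_right_comm]
  rfl

lemma det_ne_zero_of_descFactorial {n : ℕ} {B : Matrix (Fin n) (Fin n) ℂ} {u : Fin n → ℂ}
    {e : Fin n → ℕ} (hu : ∀ i, u i ≠ 0) (he : Function.Injective e)
    (hB : ∀ i l, B i l = u i * (e i).descFactorial l) : B.det ≠ 0 := by
  have hdet := Matrix.det_mul_column u (Matrix.of fun i j : Fin n => ((e i).descFactorial j : ℂ))
  rw [Matrix.ext (N := Matrix.of _) hB]
  refine hdet.trans_ne ?_
  exact mul_ne_zero (Finset.prod_ne_zero_iff.2 fun i _ => hu i) (det_descFactorial_ne_zero he)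

lemma exists_conjugateFunction_eq_zpow_mul (hf : ∀ i, Differentiable ℂ (f i))
    (he : Function.Injective e)
    (hord : ∀ i, meromorphicOrderAt (f i) z = ((e i : ℤ) : WithTop ℤ)) (i : Fin (N + 1)) :
    ∃ w : ℂ → ℂ, w z ≠ 0 ∧ DifferentiableAt ℂ w z ∧
      ∀ x ≠ z, Wronskian f x ≠ 0 → DifferentiableAt ℂ w x ∧
        conjugateFunction f i x = (x - z) ^ ((N : ℤ) - e i) * w x := by
  obtain ⟨A, u, hu, hA, hAz, hfA⟩ := exists_wronskianMatrix_eq hf hord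
  have hdetz : (A z).det ≠ 0 := det_ne_zero_of_descFactorial hu he hAz
  have hminor : ((A z).submatrix i.succAbove Fin.castSucc).det ≠ 0 :=
    det_ne_zero_of_descFactorial (fun k => hu (i.succAbove k))
      (he.comp Fin.succAbove_right_injective) fun k l => hAz _ _
  refine ⟨fun x => (A x)⁻¹ (Fin.last N) i, ?_, differentiableAt_inv_apply hA hdetz _ _,
    fun x hx hdet => ⟨differentiableAt_inv_apply hA (fun h0 => hdet ?_) _ _, ?_⟩⟩
  · refine (inv_last_apply _ _).trans_ne ?_
    exact div_ne_zero (mul_ne_zero (pow_ne_zero _ (by simp)) hminor) hdetz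
  · have hprod := congrArg Matrix.det (hfA x hx)
    rwa [Matrix.det_mul, Matrix.det_mul, h0, mul_zero, zero_mul] at hprod
  · have hxz : x - z ≠ 0 := sub_ne_zero.2 hx
    rw [conjugateFunction, hfA x hx, Matrix.mul_inv_rev, Matrix.mul_inv_rev,
      inv_diagonal fun k => pow_ne_zero _ hxz,
      inv_diagonal fun k => inv_ne_zero (pow_ne_zero _ hxz),
      Matrix.diagonal_mul, Matrix.mul_diagonal, Pi.inv_apply, Pi.inv_apply, inv_inv,
      zpow_sub₀ hxz, zpow_natCast, zpow_natCast, Fin.val_last, div_eq_mul_inv]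
    ring

end LocalForm

section CircleLaplace

lemma hasDerivAt_intervalIntegral_exp_mul {φ g : ℝ → ℂ} (hφ : Continuous φ) (hg : Continuous g)
    (a b : ℝ) (u : ℂ) :
    HasDerivAt (fun v => ∫ θ in a..b, Complex.exp (v * φ θ) * g θ)
      (∫ θ in a..b, Complex.exp (u * φ θ) * (φ θ * g θ)) u := by
  refine (intervalIntegral.hasDerivAt_integral_of_dominated_loc_of_deriv_le
    (F' := fun v θ => Complex.exp (v * φ θ) * (φ θ * g θ))
    (bound := fun θ => Real.exp ((‖u‖ + 1) * ‖φ θ‖) * ‖φ θ * g θ‖)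
    (Metric.ball_mem_nhds u one_pos)
    (.of_forall fun v => (by fun_prop : Continuous _).aestronglyMeasurable)
    ((by fun_prop : Continuous _).intervalIntegrable _ _)
    (by fun_prop : Continuous _).aestronglyMeasurable (.of_forall fun θ _ v hv => ?_)
    ((by fun_prop : Continuous _).intervalIntegrable _ _) (.of_forall fun θ _ v _ => ?_)).2
  · have hnorm : ‖v‖ ≤ ‖u‖ + 1 := by
      have hv' : ‖v - u‖ < 1 := mem_ball_iff_norm.1 hv
      linarith [norm_le_norm_add_norm_sub' v u]
    rw [norm_mul]
    gcongr
    refine (Complex.norm_exp_le_exp_norm _).trans (Real.exp_le_exp.2 ?_)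
    rw [norm_mul]
    gcongr
  · have hexp : HasDerivAt (fun v : ℂ => Complex.exp (v * φ θ))
        (Complex.exp (v * φ θ) * (1 * φ θ)) v := ((hasDerivAt_id v).mul_const _).cexp
    simpa only [one_mul, mul_assoc] using hexp.mul_const (g θ)

/-- The Laplace transform of `G` along the circle of radius `R` around `z`. -/
def circleLaplace (z : ℂ) (R : ℝ) (G : ℂ → ℂ) (u : ℂ) : ℂ :=
  ∮ x in C(z, R), Complex.exp (u * x) * G x

variable {z : ℂ} {R : ℝ} {G : ℂ → ℂ}

lemma circleIntegrable_exp_mul (hR : 0 ≤ R) (hG : ContinuousOn G (Metric.sphere z R)) (u : ℂ) :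
    CircleIntegrable (fun x => Complex.exp (u * x) * G x) z R :=
  ((by fun_prop : Continuous fun x => Complex.exp (u * x)).continuousOn.mul hG).circleIntegrable hR

lemma continuousOn_pow_mul {s : Set ℂ} (hG : ContinuousOn G s) (k : ℕ) :
    ContinuousOn (fun x => x ^ k * G x) s :=
  (continuous_pow k).continuousOn.mul hG

lemma circleLaplace_congr (hR : 0 ≤ R) {G' : ℂ → ℂ} (h : Set.EqOn G G' (Metric.sphere z R)) :
    circleLaplace z R G = circleLaplace z R G' :=
  funext fun _ => circleIntegral.integral_congr hR fun _ hx => congrArg _ (h hx)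

lemma circleLaplace_sum_smul (hR : 0 ≤ R) {ι : Type*} [Fintype ι] {G : ι → ℂ → ℂ}
    (hG : ∀ i, ContinuousOn (G i) (Metric.sphere z R)) (t : ι → ℂ) :
    circleLaplace z R (∑ i, t i • G i) = ∑ i, t i • circleLaplace z R (G i) := by
  funext u
  simp only [circleLaplace, Finset.sum_apply, Pi.smul_apply, ← circleIntegral.integral_smul]
  rw [← circleIntegral.integral_fun_sum fun i _ =>
    (circleIntegrable_exp_mul hR (hG i) u).const_fun_smul]
  simp only [Finset.mul_sum, mul_smul_comm]

lemma span_image_circleLaplace (hR : 0 ≤ R) {ι : Type*} [Finite ι] {G : ι → ℂ → ℂ}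
    (hG : ∀ i, ContinuousOn (G i) (Metric.sphere z R)) :
    Submodule.span ℂ (circleLaplace z R '' Submodule.span ℂ (Set.range G)) =
      Submodule.span ℂ (Set.range fun i => circleLaplace z R (G i)) := by
  have := Fintype.ofFinite ι
  refine le_antisymm (Submodule.span_le.2 ?_) (Submodule.span_mono ?_)
  · rintro _ ⟨g, hg, rfl⟩
    obtain ⟨t, rfl⟩ := (Submodule.mem_span_range_iff_exists_fun ℂ).1 hg
    rw [circleLaplace_sum_smul hR hG]
    exact (Submodule.mem_span_range_iff_exists_fun ℂ).2 ⟨t, rfl⟩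
  · rintro _ ⟨i, rfl⟩
    exact ⟨G i, Submodule.subset_span ⟨i, rfl⟩, rfl⟩

lemma hasDerivAt_circleLaplace (hR : 0 ≤ R) (hG : ContinuousOn G (Metric.sphere z R)) (u : ℂ) :
    HasDerivAt (circleLaplace z R G) (circleLaplace z R (fun x => x * G x) u) u := by
  have hGc : Continuous fun θ : ℝ => deriv (circleMap z R) θ * G (circleMap z R θ) := by
    simp only [deriv_circleMap]
    exact (by fun_prop : Continuous fun θ : ℝ => circleMap 0 R θ * Complex.I).mul
      (hG.comp_continuous (continuous_circleMap z R) (circleMap_mem_sphere z hR))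
  convert hasDerivAt_intervalIntegral_exp_mul (continuous_circleMap z R) hGc 0 (2 * Real.pi) u
    using 1
  · funext v
    simp only [circleLaplace, circleIntegral, smul_eq_mul, mul_left_comm]
  · simp only [circleLaplace, circleIntegral, smul_eq_mul, mul_left_comm]

lemma iteratedDeriv_circleLaplace (hR : 0 ≤ R) (hG : ContinuousOn G (Metric.sphere z R))
    (k : ℕ) : iteratedDeriv k (circleLaplace z R G) = circleLaplace z R fun x => x ^ k * G x := by
  induction k with
  | zero => simp
  | succ k ih =>
    funext u
    rw [iteratedDeriv_succ, ih,
      (hasDerivAt_circleLaplace hR (continuousOn_pow_mul hG k) u).deriv]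
    simp only [pow_succ', mul_assoc]

lemma sum_eval_dualOperator_mul_pow {N M : ℕ} {c : Fin (N + 1) → ℂ[X]}
    (hc : ∀ j, (c j).natDegree ≤ M) (u x : ℂ) :
    ∑ i : Fin (M + 1), (dualOperator M c i).eval u * x ^ (i : ℕ) =
      ∑ j, (c j).eval x * u ^ (j : ℕ) := by
  simp only [dualOperator, eval_finsetSum, eval_monomial, Finset.sum_mul]
  rw [Finset.sum_comm]
  refine Finset.sum_congr rfl fun j _ => ?_
  rw [eval_eq_sum_range' (Nat.lt_succ_of_le (hc j)), Finset.sum_range, Finset.sum_mul]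
  exact Finset.sum_congr rfl fun i _ => mul_right_comm _ _ _

lemma applyOperator_dualOperator_circleLaplace {N M : ℕ} {c : Fin (N + 1) → ℂ[X]}
    (hc : ∀ j, (c j).natDegree ≤ M) (hR : 0 ≤ R) (hG : ContinuousOn G (Metric.sphere z R))
    (u : ℂ) :
    applyOperator (dualOperator M c) (circleLaplace z R G) u =
      ∮ x in C(z, R), applyOperator c (fun x => Complex.exp (u * x)) x * G x := by
  have hterm : ∀ i : Fin (M + 1), (dualOperator M c i).eval u *
      iteratedDeriv i (circleLaplace z R G) u = ∮ x in C(z, R), (dualOperator M c i).eval u •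
        (Complex.exp (u * x) * (x ^ (i : ℕ) * G x)) := fun i => by
    rw [circleIntegral.integral_smul, iteratedDeriv_circleLaplace hR hG]
    rfl
  rw [applyOperator, Finset.sum_congr rfl fun i _ => hterm i, ← circleIntegral.integral_fun_sum
    fun (i : Fin (M + 1)) _ =>
      (circleIntegrable_exp_mul hR (continuousOn_pow_mul hG i) u).const_fun_smul]
  refine circleIntegral.integral_congr hR fun x _ => ?_
  calc ∑ i : Fin (M + 1), (dualOperator M c i).eval u • (Complex.exp (u * x) * (x ^ (i : ℕ) * G x))
      = (∑ i : Fin (M + 1), (dualOperator M c i).eval u * x ^ (i : ℕ)) *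
          (Complex.exp (u * x) * G x) := by
        rw [Finset.sum_mul]
        exact Finset.sum_congr rfl fun i _ => by rw [smul_eq_mul]; ring
    _ = (∑ j, (c j).eval x * u ^ (j : ℕ)) * (Complex.exp (u * x) * G x) := by
        rw [sum_eval_dualOperator_mul_pow hc]
    _ = applyOperator c (fun x => Complex.exp (u * x)) x * G x := by
        simp only [applyOperator, iteratedDeriv_cexp_const_mul, ← mul_assoc, Finset.sum_mul]

lemma circleLaplace_pow_mul_eq_zero (hR : 0 ≤ R) {ψ : ℂ → ℂ}
    (hψ : ∀ x ∈ Metric.closedBall z R, DifferentiableAt ℂ ψ x) (k : ℕ) :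
    circleLaplace z R (fun x => (x - z) ^ k * ψ x) = 0 := by
  funext u
  have hdiff : ∀ x ∈ Metric.closedBall z R,
      DifferentiableAt ℂ (fun x => Complex.exp (u * x) * ((x - z) ^ k * ψ x)) x := fun x hx => by
    have := hψ x hx
    fun_prop
  exact Complex.circleIntegral_eq_zero_of_differentiable_on_off_countable hR Set.countable_empty
    (fun x hx => (hdiff x hx).continuousAt.continuousWithinAt)
    fun x hx => hdiff x (Metric.ball_subset_closedBall hx.1)

lemma exists_natDegree_eq_iteratedDeriv_exp_mul {ψ : ℂ → ℂ} (hψ : AnalyticAt ℂ ψ z)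
    (hψz : ψ z ≠ 0) (d : ℕ) :
    ∃ q : ℂ[X], q.natDegree = d ∧ ∀ u,
      iteratedDeriv d (fun x => Complex.exp (u * x) * ψ x) z = quasiPolynomial q z u := by
  refine ⟨∑ i ∈ Finset.range (d + 1), monomial i ((d.choose i : ℂ) * iteratedDeriv (d - i) ψ z),
    natDegree_eq_of_le_of_coeff_ne_zero ?_ ?_, fun u => ?_⟩
  · exact natDegree_sum_le_of_forall_le _ _ fun i hi =>
      (natDegree_monomial_le _).trans (Nat.le_of_lt_succ (Finset.mem_range.1 hi))
  · simpa [finsetSum_coeff, coeff_monomial] using hψz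
  · rw [← Pi.mul_def, iteratedDeriv_mul (by fun_prop) hψ.contDiffAt, quasiPolynomial,
      eval_finsetSum, Finset.sum_mul]
    refine Finset.sum_congr rfl fun i _ => ?_
    rw [iteratedDeriv_cexp_const_mul, eval_monomial, mul_comm z u]
    ring

lemma exists_circleLaplace_eq_quasiPolynomial (hR : 0 < R) {ψ : ℂ → ℂ}
    (hψ : ∀ x ∈ Metric.closedBall z R, DifferentiableAt ℂ ψ x) (hψz : ψ z ≠ 0) (d : ℕ) :
    ∃ q : ℂ[X], q.natDegree = d ∧
      circleLaplace z R (fun x => ((x - z) ^ (d + 1))⁻¹ * ψ x) = quasiPolynomial q z := by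
  have hψa : AnalyticAt ℂ ψ z := DifferentiableOn.analyticAt
    (fun x hx => (hψ x hx).differentiableWithinAt) (Metric.closedBall_mem_nhds z hR)
  obtain ⟨q, hq, hqψ⟩ := exists_natDegree_eq_iteratedDeriv_exp_mul hψa hψz d
  set κ : ℂ := 2 * Real.pi * Complex.I / d.factorial
  have hκ : κ ≠ 0 := div_ne_zero Complex.two_pi_I_ne_zero (mod_cast d.factorial_ne_zero)
  refine ⟨C κ * q, by rw [natDegree_C_mul hκ, hq], funext fun u => ?_⟩
  have hon : DifferentiableOn ℂ (fun x => Complex.exp (u * x) * ψ x) (Metric.closedBall z R) :=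
    fun x hx => by
      have := hψ x hx
      exact DifferentiableAt.differentiableWithinAt (by fun_prop)
  calc circleLaplace z R (fun x => ((x - z) ^ (d + 1))⁻¹ * ψ x) u
      = ∮ x in C(z, R), (1 / (x - z) ^ (d + 1)) • (Complex.exp (u * x) * ψ x) := by
        simp only [circleLaplace, smul_eq_mul, one_div, mul_left_comm]
    _ = κ * quasiPolynomial q z u := by
        rw [hon.circleIntegral_one_div_sub_center_pow_smul hR d, hqψ, smul_eq_mul]
    _ = quasiPolynomial (C κ * q) z u := by
        rw [quasiPolynomial, quasiPolynomial, eval_C_mul, mul_assoc]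

end CircleLaplace

section LaplaceOfConjugate

variable {N : ℕ} {W : Submodule ℂ (ℂ → ℂ)} [FiniteDimensional ℂ W] {c : Fin (N + 1 + 1) → ℂ[X]}
  {z : ℂ} {R : ℝ}

namespace IsPrimitiveOperator

lemma continuousOn_regularizedConjugateFunction (h : IsPrimitiveOperator W c)
    (b : Module.Basis (Fin (N + 1)) ℂ W)
    (hsph : ∀ x ∈ Metric.sphere z R, (c (Fin.last (N + 1))).eval x ≠ 0) (i : Fin (N + 1)) :
    ContinuousOn (regularizedConjugateFunction b i) (Metric.sphere z R) := fun x hx => by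
  refine ContinuousAt.continuousWithinAt (ContinuousAt.mul ?_ ?_)
  · exact (differentiableAt_inv_apply (differentiable_wronskianMatrix_apply fun i =>
      h.le_entireFunctions (b i).2) (h.wronskian_ne_zero b (hsph x hx)) _ _).continuousAt
  · simp only [h.regularizingFactor_eq]
    exact (Polynomial.continuous _).continuousAt.inv₀ (hsph x hx)

lemma circleLaplace_mem_solutionSpace (h : IsPrimitiveOperator W c) {M : ℕ}
    (hM : ∀ j, (c j).natDegree ≤ M) (b : Module.Basis (Fin (N + 1)) ℂ W) (hR : 0 ≤ R)
    (hsph : ∀ x ∈ Metric.sphere z R, (c (Fin.last (N + 1))).eval x ≠ 0) (i : Fin (N + 1)) :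
    circleLaplace z R (regularizedConjugateFunction b i) ∈ solutionSpace (dualOperator M c) := by
  have hcont := h.continuousOn_regularizedConjugateFunction b hsph i
  refine ⟨fun u => (hasDerivAt_circleLaplace hR hcont u).differentiableAt, fun u => ?_⟩
  rw [applyOperator_dualOperator_circleLaplace hM hR hcont]
  -- Variation of parameters provides a primitive of the integrand.
  refine circleIntegral.integral_eq_zero_of_hasDerivWithinAt (f := variationCoeff
    (fun i => (b i : ℂ → ℂ)) (fun x => Complex.exp (u * x)) i) hR fun x hx => ?_
  have hprim := hasDerivAt_variationCoeff (fun i => h.le_solutionSpace (b i).2)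
    (by fun_prop : Differentiable ℂ fun x => Complex.exp (u * x))
    (h.wronskian_ne_zero b (hsph x hx)) (hsph x hx) i
  rw [regularizedConjugateFunction, h.regularizingFactor_eq, ← div_eq_mul_inv, mul_div_left_comm,
    mul_comm (conjugateFunction _ i x)]
  exact hprim.hasDerivWithinAt

lemma exists_regularizedConjugateFunction_eq (h : IsPrimitiveOperator W c)
    (b : Module.Basis (Fin (N + 1)) ℂ W) {e : Fin (N + 1) → ℕ} (he : Function.Injective e)
    (hord : ∀ i, meromorphicOrderAt (b i : ℂ → ℂ) z = ((e i : ℤ) : WithTop ℤ))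
    (hball : ∀ x ∈ Metric.closedBall z R, x ≠ z → (c (Fin.last (N + 1))).eval x ≠ 0)
    (i : Fin (N + 1)) :
    ∃ ψ : ℂ → ℂ, ψ z ≠ 0 ∧ (∀ x ∈ Metric.closedBall z R, DifferentiableAt ℂ ψ x) ∧
      ∀ x ∈ Metric.closedBall z R, x ≠ z → regularizedConjugateFunction b i x =
        (x - z) ^ ((N : ℤ) - e i - (c (Fin.last (N + 1))).rootMultiplicity z) * ψ x := by
  obtain ⟨w, hwz, hwd, hw⟩ :=
    exists_conjugateFunction_eq_zpow_mul (fun i => h.le_entireFunctions (b i).2) he hord i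
  obtain ⟨q, hq, hqz⟩ := exists_eq_pow_rootMultiplicity_mul_and_not_dvd
    (c (Fin.last (N + 1))) h.monic.ne_zero z
  rw [dvd_iff_isRoot, IsRoot] at hqz
  set μ := (c (Fin.last (N + 1))).rootMultiplicity z
  have hc : ∀ x, (c (Fin.last (N + 1))).eval x = (x - z) ^ μ * q.eval x := fun x => by
    conv_lhs => rw [hq]
    simp
  have hqx : ∀ x ∈ Metric.closedBall z R, q.eval x ≠ 0 := fun x hx => by
    rcases eq_or_ne x z with rfl | hxz
    · exact hqz
    · exact right_ne_zero_of_mul ((hc x).symm.trans_ne (hball x hx hxz))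
  have hwx := fun x hx hxz => hw x hxz (h.wronskian_ne_zero b (hball x hx hxz))
  refine ⟨fun x => w x / q.eval x, div_ne_zero hwz hqz, fun x hx => ?_, fun x hx hxz => ?_⟩
  · refine DifferentiableAt.div ?_ q.differentiable.differentiableAt (hqx x hx)
    rcases eq_or_ne x z with rfl | hxz
    exacts [hwd, (hwx x hx hxz).1]
  · rw [regularizedConjugateFunction, h.regularizingFactor_eq, hc, (hwx x hx hxz).2,
      zpow_sub₀ (sub_ne_zero.2 hxz) _ (μ : ℤ), zpow_natCast]
    field_simp

lemma circleLaplace_regularizedConjugateFunction (h : IsPrimitiveOperator W c)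
    (b : Module.Basis (Fin (N + 1)) ℂ W) {e : Fin (N + 1) → ℕ} (he : Function.Injective e)
    (hord : ∀ i, meromorphicOrderAt (b i : ℂ → ℂ) z = ((e i : ℤ) : WithTop ℤ)) (hR : 0 < R)
    (hball : ∀ x ∈ Metric.closedBall z R, x ≠ z → (c (Fin.last (N + 1))).eval x ≠ 0)
    (i : Fin (N + 1)) :
    (e i + (c (Fin.last (N + 1))).rootMultiplicity z < N + 1 →
      circleLaplace z R (regularizedConjugateFunction b i) = 0) ∧
    ∀ d, e i + (c (Fin.last (N + 1))).rootMultiplicity z = N + 1 + d →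
      ∃ q : ℂ[X], q.natDegree = d ∧
        circleLaplace z R (regularizedConjugateFunction b i) = quasiPolynomial q z := by
  obtain ⟨ψ, hψz, hψd, hψ⟩ := h.exists_regularizedConjugateFunction_eq b he hord hball i
  have hlaplace : ∀ G : ℂ → ℂ, (∀ x ≠ z, (x - z) ^ ((N : ℤ) - e i -
      (c (Fin.last (N + 1))).rootMultiplicity z) * ψ x = G x) →
      circleLaplace z R (regularizedConjugateFunction b i) = circleLaplace z R G := fun G hG =>
    circleLaplace_congr hR.le fun x hx =>
      have hxz : x ≠ z := Metric.ne_of_mem_sphere hx hR.ne'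
      (hψ x (Metric.sphere_subset_closedBall hx) hxz).trans (hG x hxz)
  refine ⟨fun hi => ?_, fun d hi => ?_⟩
  · obtain ⟨k, hk⟩ : ∃ k : ℕ, (N : ℤ) - e i - (c (Fin.last (N + 1))).rootMultiplicity z = k :=
      Int.eq_ofNat_of_zero_le (by omega)
    rw [hlaplace _ fun x _ => by rw [hk, zpow_natCast]]
    exact circleLaplace_pow_mul_eq_zero hR.le hψd k
  · have hd : (N : ℤ) - e i - (c (Fin.last (N + 1))).rootMultiplicity z = -((d + 1 : ℕ) : ℤ) := by
      omega
    rw [hlaplace _ fun x _ => by rw [hd, zpow_neg, zpow_natCast]]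
    exact exists_circleLaplace_eq_quasiPolynomial hR hψd hψz d

lemma exists_span_image_circleLaplace_eq (h : IsPrimitiveOperator W c) {k : ℕ} {e : Fin k → ℕ}
    (hexp : exponents W z = shiftedExponents (N + 1) k e)
    (hmult : (c (Fin.last (N + 1))).rootMultiplicity z = k) (hR : 0 < R)
    (hball : ∀ x ∈ Metric.closedBall z R, x ≠ z → (c (Fin.last (N + 1))).eval x ≠ 0) :
    ∃ q : Fin k → ℂ[X], (∀ j, (q j).natDegree = e j) ∧
      Submodule.span ℂ (circleLaplace z R '' regularizedConjugateSpace W) =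
        Submodule.span ℂ (Set.range fun j => quasiPolynomial (q j) z) := by
  have hsph : ∀ x ∈ Metric.sphere z R, (c (Fin.last (N + 1))).eval x ≠ 0 := fun x hx =>
    hball x (Metric.sphere_subset_closedBall hx) (Metric.ne_of_mem_sphere hx hR.ne')
  obtain ⟨b, ε, hε, hord, hrange⟩ := exists_adapted_basis h.le_entireFunctions h.finrank_eq z
  have hlaplace := h.circleLaplace_regularizedConjugateFunction b hε hord hR hball
  rw [hmult] at hlaplace
  have hidx : ∀ j, ∃ i, ε i + k = N + 1 + e j := fun j => by
    obtain ⟨i, hi⟩ : ((N + 1 : ℕ) : ℤ) - k + e j ∈ Set.range fun i => (ε i : ℤ) :=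
      hrange ▸ hexp ▸ Or.inr ⟨j, rfl⟩
    exact ⟨i, by dsimp only at hi; omega⟩
  choose idx hidx using hidx
  choose q hqdeg hq using fun j => (hlaplace (idx j)).2 _ (hidx j)
  refine ⟨q, hqdeg, ?_⟩
  rw [regularizedConjugateSpace_eq_span h.le_entireFunctions b, span_image_circleLaplace hR.le
    (h.continuousOn_regularizedConjugateFunction b hsph)]
  refine le_antisymm (Submodule.span_le.2 ?_) (Submodule.span_mono ?_)
  · rintro _ ⟨i, rfl⟩
    have hi : (ε i : ℤ) ∈ shiftedExponents (N + 1) k e := hexp ▸ hrange ▸ ⟨i, rfl⟩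
    rcases hi with ⟨-, hlt⟩ | ⟨j, hj⟩
    · dsimp only
      rw [(hlaplace i).1 (by omega)]
      exact Submodule.zero_mem _
    · have hij : i = idx j := hε (by have := hidx j; dsimp only at hj; omega)
      exact Submodule.subset_span ⟨j, by rw [hij]; exact (hq j).symm⟩
  · rintro _ ⟨j, rfl⟩
    exact ⟨idx j, hq j⟩

lemma span_image_circleLaplace_le_solutionSpace (h : IsPrimitiveOperator W c) {M : ℕ}
    (hM : ∀ j, (c j).natDegree ≤ M) (hR : 0 ≤ R)
    (hsph : ∀ x ∈ Metric.sphere z R, (c (Fin.last (N + 1))).eval x ≠ 0) :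
    Submodule.span ℂ (circleLaplace z R '' regularizedConjugateSpace W) ≤
      solutionSpace (dualOperator M c) := by
  let b := Module.finBasisOfFinrankEq ℂ W h.finrank_eq
  rw [regularizedConjugateSpace_eq_span h.le_entireFunctions b, span_image_circleLaplace hR
    (h.continuousOn_regularizedConjugateFunction b hsph), Submodule.span_le]
  exact Set.range_subset_iff.2 fun i => h.circleLaplace_mem_solutionSpace hM b hR hsph i

end IsPrimitiveOperator

end LaplaceOfConjugate

section BispectralDual

lemma bispectralDual_eq_iSup {W : Submodule ℂ (ℂ → ℂ)} {ι : Type*} {z : ι → ℂ}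
    (hz : Set.range z = singularPoints W) (r : ℂ → ℝ) :
    bispectralDual W r = ⨆ a, Submodule.span ℂ
      (circleLaplace (z a) (r (z a)) '' regularizedConjugateSpace W) := by
  rw [← Submodule.span_iUnion, bispectralDual, ← hz]
  refine congrArg _ (Set.ext fun g => ?_)
  simp only [Set.exists_range_iff, Set.mem_iUnion]
  exact exists_congr fun a => exists_congr fun f => and_congr_right fun _ => eq_comm

lemma quasiPolynomialSpace_eq_iSup {n : ℕ} {k : Fin n → ℕ} (p : ∀ i, Fin (k i) → ℂ[X])
    (lam : Fin n → ℂ) :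
    quasiPolynomialSpace p lam =
      ⨆ i, Submodule.span ℂ (Set.range fun j => quasiPolynomial (p i j) (lam i)) := by
  rw [← Submodule.span_iUnion, quasiPolynomialSpace_eq_span_range,
    Set.range_sigma_eq_iUnion_range]

namespace IsPrimitiveOperator

variable {N : ℕ} {W : Submodule ℂ (ℂ → ℂ)} [FiniteDimensional ℂ W] {c : Fin (N + 1) → ℂ[X]}
  {r : ℂ → ℝ}

lemma exists_eq_add_one_of_mem_singularPoints (h : IsPrimitiveOperator W c) {z : ℂ}
    (hz : z ∈ singularPoints W) : ∃ n, N = n + 1 := by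
  refine Nat.exists_eq_add_one_of_ne_zero ?_
  rintro rfl
  obtain ⟨j, hj⟩ := h.exists_eval_ne_zero z
  rw [Subsingleton.elim (α := Fin 1) j (Fin.last 0)] at hj
  exact hj (h.mem_singularPoints_iff.1 hz)

lemma eval_last_ne_zero_of_smallCircles (h : IsPrimitiveOperator W c) (hr : SmallCircles W r)
    {z : ℂ} (hz : z ∈ singularPoints W) {x : ℂ} (hx : x ∈ Metric.closedBall z (r z))
    (hxz : x ≠ z) : (c (Fin.last N)).eval x ≠ 0 := fun h0 =>
  (hr z hz).2 x (h.mem_singularPoints_iff.2 h0) hxz hx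

lemma exists_bispectralDual_eq (h : IsPrimitiveOperator W c) (hr : SmallCircles W r) {m : ℕ}
    {z : Fin m → ℂ} (hz : Set.range z = singularPoints W) {k : Fin m → ℕ}
    {e : ∀ a, Fin (k a) → ℕ} (hexp : ∀ a, exponents W (z a) = shiftedExponents N (k a) (e a))
    (hmult : ∀ a, (c (Fin.last N)).rootMultiplicity (z a) = k a) :
    ∃ q : ∀ a, Fin (k a) → ℂ[X], (∀ a b, (q a b).natDegree = e a b) ∧
      bispectralDual W r = quasiPolynomialSpace q z := by
  have hlocal : ∀ a, ∃ q : Fin (k a) → ℂ[X], (∀ b, (q b).natDegree = e a b) ∧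
      Submodule.span ℂ (circleLaplace (z a) (r (z a)) '' regularizedConjugateSpace W) =
        Submodule.span ℂ (Set.range fun b => quasiPolynomial (q b) (z a)) := fun a => by
    have hza : z a ∈ singularPoints W := hz ▸ ⟨a, rfl⟩
    obtain ⟨N, rfl⟩ := h.exists_eq_add_one_of_mem_singularPoints hza
    exact h.exists_span_image_circleLaplace_eq (hexp a) (hmult a) (hr _ hza).1
      fun x => h.eval_last_ne_zero_of_smallCircles hr hza
  choose q hdeg hspan using hlocal
  refine ⟨q, hdeg, ?_⟩
  rw [bispectralDual_eq_iSup hz, quasiPolynomialSpace_eq_iSup]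
  exact iSup_congr hspan

lemma bispectralDual_le_solutionSpace (h : IsPrimitiveOperator W c) (hr : SmallCircles W r)
    {M : ℕ} (hM : ∀ j, (c j).natDegree ≤ M) :
    bispectralDual W r ≤ solutionSpace (dualOperator M c) := by
  rw [bispectralDual_eq_iSup Subtype.range_coe]
  refine iSup_le fun ⟨z, hz⟩ => ?_
  obtain ⟨N, rfl⟩ := h.exists_eq_add_one_of_mem_singularPoints hz
  have hR := (hr z hz).1
  exact h.span_image_circleLaplace_le_solutionSpace hM hR.le fun x hx =>
    h.eval_last_ne_zero_of_smallCircles hr hz (Metric.sphere_subset_closedBall hx)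
      (Metric.ne_of_mem_sphere hx hR.ne')

end IsPrimitiveOperator

end BispectralDual

section Duality

lemma natDegree_eq_sum_rootMultiplicity {ι : Type*} [Fintype ι] {z : ι → ℂ}
    (hz : Function.Injective z) {q : ℂ[X]} (hq : q ≠ 0)
    (hroots : ∀ x, q.IsRoot x ↔ x ∈ Set.range z) :
    q.natDegree = ∑ a, q.rootMultiplicity (z a) := by
  classical
  have himage : q.roots.toFinset = Finset.univ.image z := by
    ext x
    rw [Multiset.mem_toFinset, mem_roots hq, hroots]
    simp
  rw [← IsAlgClosed.card_roots_eq_natDegree (p := q), ← Multiset.toFinset_sum_count_eq, himage,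
    Finset.sum_image hz.injOn]
  simp

/-- The set of degrees of a family of polynomials. -/
def degreeFinset {k : ℕ} (p : Fin k → ℂ[X]) : Finset ℕ :=
  Finset.univ.image fun j => (p j).natDegree

lemma card_degreeFinset {k : ℕ} {p : Fin k → ℂ[X]}
    (hdeg : Function.Injective fun j => (p j).natDegree) : (degreeFinset p).card = k := by
  rw [degreeFinset, Finset.card_image_of_injective _ hdeg, Finset.card_fin]

variable {n N : ℕ} {k : Fin n → ℕ} {p : ∀ i, Fin (k i) → ℂ[X]} {lam : Fin n → ℂ}
  {c : Fin (N + 1) → ℂ[X]}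

lemma coe_degreeFinset_subset (hp : ∀ i j, p i j ≠ 0)
    (hV : quasiPolynomialSpace p lam ≤ solutionSpace c) (i : Fin n) :
    ↑(degreeFinset (p i)) ⊆ quasiPolynomialDegrees c (lam i) := by
  rw [degreeFinset, Finset.coe_image, Finset.coe_univ, Set.image_univ]
  rintro _ ⟨j, rfl⟩
  exact ⟨p i j, hp i j, rfl, hV (quasiPolynomial_mem_quasiPolynomialSpace p lam i j)⟩

lemma exists_isPrimitiveOperator_quasiPolynomialSpace (hp : ∀ i j, p i j ≠ 0)
    (hdeg : ∀ i, Function.Injective fun j => (p i j).natDegree) (hlam : Function.Injective lam) :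
    ∃ c : Fin (∑ i, k i + 1) → ℂ[X], IsPrimitiveOperator (quasiPolynomialSpace p lam) c := by
  obtain ⟨c, hc, hV⟩ := exists_quasiPolynomialSpace_le_solutionSpace rfl p lam
  exact exists_isPrimitiveOperator (finrank_quasiPolynomialSpace hp hdeg hlam) hc hV

lemma monic_prod_X_sub_C_pow (lam : Fin n → ℂ) (k : Fin n → ℕ) :
    (∏ i, (X - C (lam i)) ^ k i).Monic :=
  monic_prod_of_monic _ _ fun _ _ => (monic_X_sub_C _).pow _

lemma isRoot_prod_X_sub_C_pow_iff (hk : ∀ i, 0 < k i) {u : ℂ} :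
    (∏ i, (X - C (lam i)) ^ k i).IsRoot u ↔ u ∈ Set.range lam := by
  rw [IsRoot, eval_prod, Finset.prod_eq_zero_iff]
  simp [(hk _).ne', sub_eq_zero, eq_comm (a := u)]

lemma exponents_dual_eq {U : Submodule ℂ (ℂ → ℂ)} [FiniteDimensional ℂ U] {M d l : ℕ}
    {q : Fin l → ℂ[X]} {z : ℂ} (hdeg : Function.Injective fun j => (q j).natDegree)
    (hM : ∀ j, (c j).natDegree ≤ M) (hq : ↑(degreeFinset q) ⊆ quasiPolynomialDegrees c z)
    (hlast : dualOperator M c (Fin.last M) ≠ 0)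
    (hroot : (dualOperator M c (Fin.last M)).rootMultiplicity z = l)
    (hU : U ≤ solutionSpace (dualOperator M c)) (hdim : Module.finrank ℂ U = M)
    (hd : d + l = M) :
    exponents U z = shiftedExponents M l fun j => (q j).natDegree := by
  have hexp : ∀ t : ℕ, (t : ℤ) ∈ exponents U z ↔ t < d ∨ ∃ s ∈ degreeFinset q, t = s + d :=
    fun t => by
      rw [← card_degreeFinset hdeg] at hroot hd
      exact natCast_mem_exponents_dual_iff hM hq hlast hroot hU hdim hd
  have hMd : (M : ℤ) - l = d := by omega
  ext t
  rw [shiftedExponents, hMd]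
  constructor
  · intro ht
    obtain ⟨t, rfl⟩ := exists_natCast_eq_of_mem_exponents
      (hU.trans (solutionSpace_le_entireFunctions _)) ht
    refine ((hexp t).1 ht).imp (fun hlt => ⟨by omega, by omega⟩) ?_
    rintro ⟨s, hs, rfl⟩
    obtain ⟨j, -, rfl⟩ := Finset.mem_image.1 hs
    exact ⟨j, by push_cast; exact add_comm _ _⟩
  · rintro (⟨h0, hlt⟩ | ⟨j, rfl⟩)
    · lift t to ℕ using h0
      exact (hexp t).2 (Or.inl (by omega))
    · refine mod_cast (hexp (d + (q j).natDegree)).2 (Or.inr ⟨_, ?_, add_comm _ _⟩)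
      exact Finset.mem_image_of_mem _ (Finset.mem_univ j)

namespace IsPrimitiveOperator

variable {W : Submodule ℂ (ℂ → ℂ)} [FiniteDimensional ℂ W] {M : ℕ}

lemma natDegree_last_eq_sum (h : IsPrimitiveOperator W c) {ι : Type*} [Fintype ι] {z : ι → ℂ}
    (hz : Function.Injective z) (hsing : Set.range z = singularPoints W) {m : ι → ℕ}
    (hmult : ∀ a, (c (Fin.last N)).rootMultiplicity (z a) = m a) :
    (c (Fin.last N)).natDegree = ∑ a, m a := by
  rw [natDegree_eq_sum_rootMultiplicity hz h.monic.ne_zero fun x => by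
    rw [hsing, h.mem_singularPoints_iff]]
  exact Finset.sum_congr rfl fun a _ => hmult a

lemma isRegularizedFundamentalOperator_iff (h : IsPrimitiveOperator W c)
    (hM : ∀ j, (c j).natDegree ≤ M) {A : Fin (M + 1) → Fin (N + 1) → ℂ} :
    (IsRegularizedFundamentalOperator N W fun j x => ∑ i, A i j * x ^ (i : ℕ)) ↔
      ∀ i j, A i j = (c j).coeff i := by
  let d : Fin (N + 1) → ℂ[X] := fun j => ∑ i : Fin (M + 1), monomial (i : ℕ) (A i j)
  have hd : (fun j x => ∑ i, A i j * x ^ (i : ℕ)) = fun j x => (d j).eval x := by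
    simp [d, eval_finsetSum]
  rw [hd]
  refine ⟨fun hA => ?_, ?_⟩
  · rw [← h.eq_of_isRegularizedFundamentalOperator hA]
    simp [d, coeff_monomial, Fin.val_inj]
  · intro hA
    have hdc : d = c := funext fun j => by
      rw [(c j).as_sum_range' (M + 1) (Nat.lt_succ_of_le (hM j)), Finset.sum_range]
      simp only [d, hA]
    exact hdc ▸ h.isRegularizedFundamentalOperator

section QuasiPolynomialSpace

variable {U : Submodule ℂ (ℂ → ℂ)}

lemma natDegree_le (h : IsPrimitiveOperator (quasiPolynomialSpace p lam) c)
    (hp : ∀ i j, p i j ≠ 0) (hdeg : ∀ i, Function.Injective fun j => (p i j).natDegree)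
    (hlam : Function.Injective lam) (hM : (c (Fin.last N)).natDegree = M) (j : Fin (N + 1)) :
    (c j).natDegree ≤ M := by
  refine hM ▸ natDegree_le_natDegree_last hlam (coe_degreeFinset_subset hp h.le_solutionSpace) ?_ j
  simp only [card_degreeFinset (hdeg _), ← h.finrank_eq, finrank_quasiPolynomialSpace hp hdeg hlam]

lemma dualOperator_last_eq (h : IsPrimitiveOperator (quasiPolynomialSpace p lam) c)
    (hp : ∀ i j, p i j ≠ 0) (hdeg : ∀ i, Function.Injective fun j => (p i j).natDegree)
    (hlam : Function.Injective lam) (hM : (c (Fin.last N)).natDegree = M) :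
    dualOperator M c (Fin.last M) = ∏ i, (X - C (lam i)) ^ k i := by
  subst hM
  rw [dualOperator_last_eq_prod h.monic hlam (coe_degreeFinset_subset hp h.le_solutionSpace)]
  · simp only [card_degreeFinset (hdeg _)]
  · simp only [card_degreeFinset (hdeg _), ← h.finrank_eq,
      finrank_quasiPolynomialSpace hp hdeg hlam]

lemma exists_add_eq_and_eval_dualOperator_ne_zero
    (h : IsPrimitiveOperator (quasiPolynomialSpace p lam) c)
    (hp : ∀ i j, 0 < (p i j).natDegree)
    (hdeg : ∀ i, Function.Injective fun j => (p i j).natDegree) (hlam : Function.Injective lam)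
    (hM : (c (Fin.last N)).natDegree = M) (i : Fin n) :
    ∃ l : Fin (M + 1), (l : ℕ) + k i = M ∧ (dualOperator M c l).eval (lam i) ≠ 0 := by
  have hp0 : ∀ i j, p i j ≠ 0 := fun i j => ne_zero_of_natDegree_gt (hp i j)
  have hlast := h.dualOperator_last_eq hp0 hdeg hlam hM
  rw [← card_degreeFinset (hdeg i)]
  refine exists_eval_dualOperator_ne_zero (h.natDegree_le hp0 hdeg hlam hM)
    (coe_degreeFinset_subset hp0 h.le_solutionSpace i) ?_ ?_ fun h0 => ?_
  · exact hlast ▸ (monic_prod_X_sub_C_pow lam k).ne_zero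
  · rw [hlast, rootMultiplicity_prod_X_sub_C_pow hlam, card_degreeFinset (hdeg i)]
  · obtain ⟨j, -, hj⟩ := Finset.mem_image.1 h0
    exact (hp i j).ne' hj

lemma dual (h : IsPrimitiveOperator (quasiPolynomialSpace p lam) c) (hk : ∀ i, 0 < k i)
    (hp : ∀ i j, 0 < (p i j).natDegree)
    (hdeg : ∀ i, Function.Injective fun j => (p i j).natDegree) (hlam : Function.Injective lam)
    (hM : (c (Fin.last N)).natDegree = M) (hU : U ≤ solutionSpace (dualOperator M c))
    (hdim : Module.finrank ℂ U = M) : IsPrimitiveOperator U (dualOperator M c) := by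
  have hlast := h.dualOperator_last_eq (fun i j => ne_zero_of_natDegree_gt (hp i j)) hdeg hlam hM
  refine ⟨hU, hdim, hlast ▸ monic_prod_X_sub_C_pow lam k, fun u => ?_⟩
  by_cases hu : u ∈ Set.range lam
  · obtain ⟨i, rfl⟩ := hu
    obtain ⟨l, -, hl⟩ := h.exists_add_eq_and_eval_dualOperator_ne_zero hp hdeg hlam hM i
    exact ⟨l, hl⟩
  · exact ⟨Fin.last M, fun hroot => hu ((isRoot_prod_X_sub_C_pow_iff hk).1 (hlast ▸ hroot))⟩

lemma singularPoints_dual (h : IsPrimitiveOperator (quasiPolynomialSpace p lam) c)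
    [FiniteDimensional ℂ U] (hk : ∀ i, 0 < k i) (hp : ∀ i j, 0 < (p i j).natDegree)
    (hdeg : ∀ i, Function.Injective fun j => (p i j).natDegree) (hlam : Function.Injective lam)
    (hM : (c (Fin.last N)).natDegree = M) (hU : U ≤ solutionSpace (dualOperator M c))
    (hdim : Module.finrank ℂ U = M) : singularPoints U = Set.range lam := by
  ext u
  rw [(h.dual hk hp hdeg hlam hM hU hdim).mem_singularPoints_iff,
    h.dualOperator_last_eq (fun i j => ne_zero_of_natDegree_gt (hp i j)) hdeg hlam hM,
    isRoot_prod_X_sub_C_pow_iff hk]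

lemma exponents_dual (h : IsPrimitiveOperator (quasiPolynomialSpace p lam) c)
    [FiniteDimensional ℂ U] (hp : ∀ i j, 0 < (p i j).natDegree)
    (hdeg : ∀ i, Function.Injective fun j => (p i j).natDegree) (hlam : Function.Injective lam)
    (hM : (c (Fin.last N)).natDegree = M) (hU : U ≤ solutionSpace (dualOperator M c))
    (hdim : Module.finrank ℂ U = M) (i : Fin n) :
    exponents U (lam i) = shiftedExponents M (k i) fun j => (p i j).natDegree := by
  have hp0 : ∀ i j, p i j ≠ 0 := fun i j => ne_zero_of_natDegree_gt (hp i j)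
  have hlast := h.dualOperator_last_eq hp0 hdeg hlam hM
  obtain ⟨d, hd, -⟩ := h.exists_add_eq_and_eval_dualOperator_ne_zero hp hdeg hlam hM i
  refine exponents_dual_eq (hdeg i) (h.natDegree_le hp0 hdeg hlam hM)
    (coe_degreeFinset_subset hp0 h.le_solutionSpace i) ?_ ?_ hU hdim hd
  · exact hlast ▸ (monic_prod_X_sub_C_pow lam k).ne_zero
  · rw [hlast, rootMultiplicity_prod_X_sub_C_pow hlam]

end QuasiPolynomialSpace

end IsPrimitiveOperator

end Duality

end

theorem theorem2p5
    -- the space `V` of quasi-polynomials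
    (n : ℕ) (Ni : Fin n → ℕ) (hNi : ∀ i, 0 < Ni i)
    (deg : ∀ i, Fin (Ni i) → ℕ) (hdeg_pos : ∀ i j, 0 < deg i j)
    (hdeg_mono : ∀ i, StrictMono (deg i))
    (p : ∀ i, Fin (Ni i) → Polynomial ℂ) (hp : ∀ i j, (p i j).natDegree = deg i j)
    (lam : Fin n → ℂ) (hlam : Function.Injective lam)
    (N : ℕ) (hN : N = ∑ i, Ni i)
    (V : Submodule ℂ (ℂ → ℂ)) (hV : V = quasiPolynomialSpace p lam)
    -- its singular points and its exponents there
    (m : ℕ) (z : Fin m → ℂ) (hz : Function.Injective z) (hsing : Set.range z = singularPoints V)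
    (Ma : Fin m → ℕ) (hMa : ∀ a, 1 ≤ Ma a ∧ Ma a ≤ N)
    (e : ∀ a, Fin (Ma a) → ℕ) (he_pos : ∀ a b, 0 < e a b) (he_mono : ∀ a, StrictMono (e a))
    (hexp : ∀ a, exponents V (z a) = shiftedExponents N (Ma a) (e a))
    (M : ℕ) (hM : M = ∑ a, Ma a)
    -- small circles around the singular points, and the bispectral dual
    (r : ℂ → ℝ) (hr : SmallCircles V r)
    (U : Submodule ℂ (ℂ → ℂ)) (hU : U = bispectralDual V r) :
    -- (i)
    (FiniteDimensional ℂ U ∧ Module.finrank ℂ U = M) ∧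
    -- (ii)
    (∀ a b, ∃ q : Polynomial ℂ, q.natDegree = e a b ∧
      (fun u : ℂ => q.eval u * Complex.exp (z a * u)) ∈ U) ∧
    -- (iii)
    ((∃ A : Fin (M + 1) → Fin (N + 1) → ℂ,
        IsRegularizedFundamentalOperator N V fun j x => ∑ i, A i j * x ^ (i : ℕ)) ∧
      ∀ A : Fin (M + 1) → Fin (N + 1) → ℂ,
        (IsRegularizedFundamentalOperator N V fun j x => ∑ i, A i j * x ^ (i : ℕ)) →
        IsRegularizedFundamentalOperator M U fun i u => ∑ j, A i j * u ^ (j : ℕ)) ∧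
    -- (iv)
    singularPoints U = Set.range lam ∧
    -- (v)
    (∀ i, exponents U (lam i) = shiftedExponents M (Ni i) (deg i)) := by
  subst hN hV hM
  obtain rfl : deg = fun i j => (p i j).natDegree := funext₂ fun i j => (hp i j).symm
  have hp0 : ∀ i j, p i j ≠ 0 := fun i j => ne_zero_of_natDegree_gt (hdeg_pos i j)
  have hdeg := fun i => (hdeg_mono i).injective
  obtain ⟨c, h⟩ := exists_isPrimitiveOperator_quasiPolynomialSpace hp0 hdeg hlam
  have hmult : ∀ a, (c (Fin.last _)).rootMultiplicity (z a) = Ma a := fun a =>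
    rootMultiplicity_last_eq h.le_solutionSpace h.finrank_eq (h.exists_eval_ne_zero _) (hMa a).2
      (he_pos a) (hexp a)
  have hM := h.natDegree_last_eq_sum hz hsing hmult
  have hcM := h.natDegree_le hp0 hdeg hlam hM
  obtain ⟨q, hq, hUq⟩ := h.exists_bispectralDual_eq hr hsing hexp hmult
  have hUD := hU ▸ h.bispectralDual_le_solutionSpace hr hcM
  obtain rfl := hU.trans hUq
  have hdim : Module.finrank ℂ (quasiPolynomialSpace q z) = ∑ a, Ma a :=
    finrank_quasiPolynomialSpace (fun a b => ne_zero_of_natDegree_gt (hq a b ▸ he_pos a b))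
      (fun a => by simpa only [hq] using (he_mono a).injective) hz
  have hdual := h.dual hNi hdeg_pos hdeg hlam hM hUD hdim
  refine ⟨⟨inferInstance, hdim⟩,
    fun a b => ⟨q a b, hq a b, quasiPolynomial_mem_quasiPolynomialSpace q z a b⟩,
    ⟨⟨fun i j => (c j).coeff i, (h.isRegularizedFundamentalOperator_iff hcM).2 fun _ _ => rfl⟩,
      fun A hA => (hdual.isRegularizedFundamentalOperator_iff (natDegree_dualOperator_le c)).2 ?_⟩,
    h.singularPoints_dual hNi hdeg_pos hdeg hlam hM hUD hdim,
    h.exponents_dual hdeg_pos hdeg hlam hM hUD hdim⟩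
  intro j i
  rw [coeff_dualOperator, (h.isRegularizedFundamentalOperator_iff hcM).1 hA]
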